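/- For a finite simple graph $G$ with adjacency matrix $A_G$, let $C(\mathrm{Qut}(G))$ be the universal unital $C^*$-algebra with generators $u_{ij}$, $i,j\in V(G)$, and relations $u_{ij}=u_{ij}^*=u_{ij}^2$, $\sum_l u_{il}=1=\sum_l u_{li}$ for all $i$, and $A_Gu=uA_G$. It is the $C^*$-algebra of the quantum automorphism group $\mathrm{Qut}(G)$. One says that $G$ has quantum symmetry if $C(\mathrm{Qut}(G))$ is noncommutative, and that $\mathrm{Qut}(G)$ is finite if $C(\mathrm{Qut}(G))$ is finite-dimensional. Let $H=K_{3,4}$, and for $k\in V(H)$ let $S_k$ be the set of edges of $H$ incident to $k$. Let $G_*=G_*(M_H,0)$ be the following vertex- and edge-colored graph, where $M_H\in\mathbb{F}_2^{V(H)\times E(H)}$ is the incidence matrix of $H$. - Its vertices are the pairs $(k,\alpha)$ with $k\in V(H)$, $\alpha:S_k\to\{1,-1\}$ and $\prod_{i\in S_k}\alpha_i=1$. The color of $(k,\alpha)$ is $k$. - Any two distinct vertices $(k,\alpha),(k,\beta)$ with the same $k$ are joined by an edge, whose color is the function $i\mapsto\alpha_i\beta_i$ on $S_k$. - Vertices $(k,\alpha),(l,\beta)$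 with $k\ne l$ are joined by an edge if and only if there is an $i\in S_k\cap S_l$ (necessarily unique) with $\alpha_i\beta_i=-1$. All these edges have one and the same color, denoted $-1$, which differs from the colors above. Choose pairwise distinct numbers $n_k\in\mathbb{N}_0$ for the vertex colors $k\in V(H)$, and pairwise distinct numbers $m_c\in\mathbb{N}_0$ for the edge colors $c\neq -1$ of $G_*$. Let $G_*''=G_*''(M_{K_{3,4}},0)$ be the uncolored graph obtained from $G_*$ as follows: attach a path of length $n_k$ to every vertex of color $k$; subdivide every edge of $G_*$ of color $c\ne -1$ by a new vertex and attach a path of length $m_c$ to that new vertex; forget all colors. Then, for every such choice of the $n_k$ and $m_c$, the graph $G_*''$ has quantum symmetry and its quantum automorphism group is finite, i.e. $C(\mathrm{Qut}(G_*''))$ is noncommutative and finite-dimensional. -/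

import Mathlib

universe w

open scoped ENNReal

/-! ### The quantum automorphism group of a finite graph -/

section QuantumAutomorphismGroup

/-- The defining relations of `C(Qut(G))`, for a `V × V` matrix `u` over a unital C⋆-algebra:
the entries are projections, all rows and columns sum to `1` (so `u` is a magic unitary), and `u`
commutes with the adjacency matrix of `G`. -/
structure IsQuantumAutomorphism {V : Type} [Fintype V] (G : SimpleGraph V)
    {A : Type*} [CStarAlgebra A] (u : Matrix V V A) : Prop where
  isStarProjection : ∀ i j, IsStarProjection (u i j)
  row_sum : ∀ i, ∑ l, u i l = 1
  col_sum : ∀ i, ∑ l, u l i = 1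
  adjMatrix_comm : open Classical in G.adjMatrix A * u = u * G.adjMatrix A

/-- A nontrivial unital C⋆-algebra together with a matrix satisfying the defining relations of
`C(Qut(G))`. -/
structure QutRep {V : Type} [Fintype V] (G : SimpleGraph V) : Type (w + 1) where
  carrier : Type w
  [cstarAlgebra : CStarAlgebra carrier]
  [nontrivial : Nontrivial carrier]
  u : Matrix V V carrier
  isQuantumAutomorphism : IsQuantumAutomorphism G u

attribute [instance] QutRep.cstarAlgebra QutRep.nontrivial

/-- The `ℓ^∞`-product of all C⋆-algebras carrying a matrix that satisfies the defining relations
of `C(Qut(G))`. -/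
abbrev QutProduct {V : Type} [Fintype V] (G : SimpleGraph V) : Type (w + 1) :=
  lp (fun ρ : QutRep.{w} G => ρ.carrier) ∞

noncomputable instance QutProduct.instCStarAlgebra {V : Type} [Fintype V] (G : SimpleGraph V) :
    CStarAlgebra (QutProduct.{w} G) where

/-- The universal generator `u i j`: in the coordinate `(A, v)` of the product it is `v i j`. -/
noncomputable def qutGenerator {V : Type} [Fintype V] (G : SimpleGraph V) (i j : V) :
    QutProduct.{w} G :=
  ⟨fun ρ => ρ.u i j, memℓp_infty ⟨1, by
    rintro _ ⟨ρ, rfl⟩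
    exact (ρ.isQuantumAutomorphism.isStarProjection i j).norm_le⟩⟩

/-- The C⋆-algebra `C(Qut(G))` of the quantum automorphism group of `G`: the universal C⋆-algebra
with generators `u i j`, `i j : V`, and the relations of `IsQuantumAutomorphism`. It is realized as
the closed unital ⋆-subalgebra that the universal generators generate in the product of all
C⋆-algebras with such elements; its universal property is `qutAlgebra_universal`. -/
noncomputable def qutAlgebra {V : Type} [Fintype V] (G : SimpleGraph V) :
    StarSubalgebra ℂ (QutProduct.{w} G) :=
  (StarAlgebra.adjoin ℂ
    (Set.range fun p : V × V => qutGenerator.{w} G p.1 p.2)).topologicalClosure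

noncomputable instance qutAlgebra.instCStarAlgebra {V : Type} [Fintype V] (G : SimpleGraph V) :
    CStarAlgebra (qutAlgebra.{w} G) :=
  StarSubalgebra.cstarAlgebra _ (h_closed := StarSubalgebra.isClosed_topologicalClosure _)

/-- The fundamental representation of `Qut(G)`: the matrix of generators of `C(Qut(G))`. -/
noncomputable def qutMatrix {V : Type} [Fintype V] (G : SimpleGraph V) :
    Matrix V V (qutAlgebra.{w} G) := fun i j =>
  ⟨qutGenerator G i j, StarSubalgebra.le_topologicalClosure _
    (StarAlgebra.subset_adjoin ℂ _ ⟨(i, j), rfl⟩)⟩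

/-- Evaluation of an element of the product at the coordinate `ρ`. -/
noncomputable def QutRep.eval {V : Type} [Fintype V] {G : SimpleGraph V} (ρ : QutRep.{w} G) :
    QutProduct.{w} G →⋆ₐ[ℂ] ρ.carrier where
  toFun f := f ρ
  map_one' := rfl
  map_mul' _ _ := rfl
  map_zero' := rfl
  map_add' _ _ := rfl
  commutes' _ := rfl
  map_star' _ := rfl

/-- The generators of `C(Qut(G))` satisfy the defining relations. -/
theorem qutMatrix_isQuantumAutomorphism {V : Type} [Fintype V] (G : SimpleGraph V) :
    IsQuantumAutomorphism G (qutMatrix.{w} G) where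
  isStarProjection i j :=
    { isIdempotentElem := by
        refine Subtype.ext (lp.ext (funext fun ρ => ?_))
        exact (ρ.isQuantumAutomorphism.isStarProjection i j).isIdempotentElem
      isSelfAdjoint := by
        refine Subtype.ext (lp.ext (funext fun ρ => ?_))
        exact (ρ.isQuantumAutomorphism.isStarProjection i j).isSelfAdjoint }
  row_sum i := by
    refine Subtype.ext (lp.ext (funext fun ρ => ?_))
    change ρ.eval ((qutAlgebra G).subtype (∑ l, qutMatrix G i l)) = 1
    rw [map_sum, map_sum]
    exact ρ.isQuantumAutomorphism.row_sum i
  col_sum i := by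
    refine Subtype.ext (lp.ext (funext fun ρ => ?_))
    change ρ.eval ((qutAlgebra G).subtype (∑ l, qutMatrix G l i)) = 1
    rw [map_sum, map_sum]
    exact ρ.isQuantumAutomorphism.col_sum i
  adjMatrix_comm := by
    classical
    refine Matrix.ext fun i j => Subtype.ext (lp.ext (funext fun ρ => ?_))
    have h := congrFun (congrFun ρ.isQuantumAutomorphism.adjMatrix_comm i) j
    simp only [SimpleGraph.adjMatrix_mul_apply, SimpleGraph.mul_adjMatrix_apply] at h ⊢
    change ρ.eval ((qutAlgebra G).subtype (∑ k ∈ G.neighborFinset i, qutMatrix G k j)) =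
      ρ.eval ((qutAlgebra G).subtype (∑ k ∈ G.neighborFinset j, qutMatrix G i k))
    rw [map_sum, map_sum, map_sum, map_sum]
    exact h

/-- The universal property of `C(Qut(G))`. -/
theorem qutAlgebra_universal {V : Type} [Fintype V] (G : SimpleGraph V) (B : Type w)
    [CStarAlgebra B] [Nontrivial B] (v : Matrix V V B) (hv : IsQuantumAutomorphism G v) :
    ∃! φ : qutAlgebra.{w} G →⋆ₐ[ℂ] B, ∀ i j, φ (qutMatrix G i j) = v i j := by
  refine ⟨(QutRep.eval ⟨B, v, hv⟩).comp (qutAlgebra G).subtype, fun i j => rfl, ?_⟩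
  intro ψ hψ
  have hc : ∀ χ : qutAlgebra.{w} G →⋆ₐ[ℂ] B, Continuous χ := fun χ =>
    (NonUnitalStarAlgHom.instContinuousLinearMapClassComplex.toContinuousMapClass).map_continuous χ
  refine StarAlgHom.ext_topologicalClosure (hc ψ) (hc _) ?_
  refine StarAlgHom.ext_adjoin ?_
  rintro ⟨_, _⟩ ⟨⟨i, j⟩, rfl⟩
  exact hψ i j

/-- `G` has quantum symmetry if `C(Qut(G))` is not commutative. -/
def HasQuantumSymmetry {V : Type} [Fintype V] (G : SimpleGraph V) : Prop :=
  ∃ a b : qutAlgebra.{w} G, a * b ≠ b * a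

/-- The quantum automorphism group of `G` is finite if `C(Qut(G))` is finite-dimensional. -/
def HasFiniteQut {V : Type} [Fintype V] (G : SimpleGraph V) : Prop :=
  FiniteDimensional ℂ (qutAlgebra.{w} G)

end QuantumAutomorphismGroup

/-! ### Colored graphs and decoloring -/

section Decoloring

/-- An edge-colored graph. Only the values of `edgeColor` on edges matter. -/
structure EdgeColoredGraph (V T : Type) where
  graph : SimpleGraph V
  edgeColor : Sym2 V → T

/-- A vertex- and edge-colored graph. -/
structure ColoredGraph (V S T : Type) extends EdgeColoredGraph V T where
  vertexColor : V → S

/-- The vertices of the graph `G'`: the pair `(v, i)` is the vertex at distance `i` from `v` on the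
path of length `len (c v)` attached to `v`, with `(v, 0)` the vertex `v` itself. -/
abbrev PathVertex {V S T : Type} (G : ColoredGraph V S T) (len : S → ℕ) : Type :=
  Σ v : V, Fin (len (G.vertexColor v) + 1)

/-- The edge-colored graph `G'`: a path of length `len s` is attached to every vertex of color `s`,
all edges of these paths get the edge color `c₀`, and the vertex colors are forgotten. -/
def ColoredGraph.attachPaths {V S T : Type} (G : ColoredGraph V S T) (c₀ : T) (len : S → ℕ) :
    EdgeColoredGraph (PathVertex G len) T where
  graph :=
    { Adj := fun x y =>
        (x.2.val = 0 ∧ y.2.val = 0 ∧ G.graph.Adj x.1 y.1) ∨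
        (x.1 = y.1 ∧ (x.2.val + 1 = y.2.val ∨ y.2.val + 1 = x.2.val))
      symm := ⟨by
        rintro x y (⟨hx, hy, h⟩ | ⟨h, h'⟩)
        · exact Or.inl ⟨hy, hx, h.symm⟩
        · exact Or.inr ⟨h.symm, h'.symm⟩⟩
      loopless := ⟨by
        rintro x (⟨_, _, h⟩ | ⟨_, h⟩)
        · exact G.graph.loopless.irrefl _ h
        · omega⟩ }
  edgeColor := Sym2.lift ⟨fun x y =>
    if x.2.val = 0 ∧ y.2.val = 0 then G.edgeColor s(x.1, y.1) else c₀, by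
      intro x y
      simp only [and_comm, Sym2.eq_swap]⟩

/-- The edges of an edge-colored graph whose color is not `c₀`. -/
abbrev EdgeColoredGraph.OtherEdge {V T : Type} (G : EdgeColoredGraph V T) (c₀ : T) : Type :=
  {e : Sym2 V // e ∈ G.graph.edgeSet ∧ G.edgeColor e ≠ c₀}

/-- The vertices of the graph `G''`: the old ones and, for every edge `e` of color `c ≠ c₀`, the
vertices `(e, i)`, where `(e, 0)` subdivides `e` and `(e, i)` is the vertex at distance `i` from it
on the path of length `len c` attached to it. -/
abbrev SubdivisionVertex {V T : Type} (G : EdgeColoredGraph V T) (c₀ : T) (len : T → ℕ) : Type :=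
  V ⊕ (Σ e : G.OtherEdge c₀, Fin (len (G.edgeColor e.1) + 1))

/-- The adjacency relation of the graph `G''`. -/
def EdgeColoredGraph.SubdivisionAdj {V T : Type} (G : EdgeColoredGraph V T) (c₀ : T)
    (len : T → ℕ) : SubdivisionVertex G c₀ len → SubdivisionVertex G c₀ len → Prop
  | .inl v, .inl w => G.graph.Adj v w ∧ G.edgeColor s(v, w) = c₀
  | .inl v, .inr x => v ∈ x.1.1 ∧ x.2.val = 0
  | .inr x, .inl v => v ∈ x.1.1 ∧ x.2.val = 0
  | .inr x, .inr y => x.1 = y.1 ∧ (x.2.val + 1 = y.2.val ∨ y.2.val + 1 = x.2.val)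

/-- The uncolored graph `G''`: every edge of color `c ≠ c₀` is subdivided, a path of length `len c`
is attached to the subdividing vertex, and all colors are forgotten. -/
def EdgeColoredGraph.subdivide {V T : Type} (G : EdgeColoredGraph V T) (c₀ : T) (len : T → ℕ) :
    SimpleGraph (SubdivisionVertex G c₀ len) where
  Adj := G.SubdivisionAdj c₀ len
  symm := ⟨by
    rintro (v | x) (w | y) h
    · exact ⟨h.1.symm, by rw [Sym2.eq_swap]; exact h.2⟩
    · exact h
    · exact h
    · exact ⟨h.1.symm, h.2.symm⟩⟩
  loopless := ⟨by
    rintro (v | x) h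
    · exact G.graph.loopless.irrefl _ h.1
    · have := h.2
      omega⟩

end Decoloring

/-! ### The graphs of linear systems -/

section LinearSystems

/-- The vertices of the graph of the linear system `M x = b`: pairs `(k, α)` of an equation `k` and
a function `α : S_k → {1, -1}` on `S_k = {i | M k i = 1}` whose product is `(-1)^{b k}`. -/
abbrev SolutionVertex {m n : Type} [Fintype n] (M : Matrix m n (ZMod 2)) (b : m → ZMod 2) : Type :=
  Σ k : m, {α : {i : n // M k i = 1} → ℤˣ // ∏ i, α i = if b k = 0 then 1 else -1}

/-- The value `α_i` at the vertex `(k, α)`, extended by `0` to `i ∉ S_k`. -/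
def SolutionVertex.sign {m n : Type} [Fintype n] {M : Matrix m n (ZMod 2)} {b : m → ZMod 2}
    (v : SolutionVertex M b) (i : n) : ℤ :=
  if h : M v.1 i = 1 then (v.2.1 ⟨i, h⟩ : ℤ) else 0

/-- The colored graph `G_*(M, b)`. The vertex `(k, α)` has color `k`. Two distinct vertices `(k, α)`,
`(k, β)` for the same equation are always adjacent, and the edge has as color the function
`α △ β : i ↦ α_i β_i` on `S_k` (extended by `0`, and written `some (α △ β)`). Vertices `(k, α)`,
`(l, β)` with `k ≠ l` are adjacent if and only if `α_i β_i = -1` for an `i ∈ S_k ∩ S_l` (there is at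
most one such `i` if `M` is the incidence matrix of a graph), and all these edges have the same
color `-1`, written `none`. -/
def starGraph {m n : Type} [DecidableEq m] [Fintype n] (M : Matrix m n (ZMod 2))
    (b : m → ZMod 2) : ColoredGraph (SolutionVertex M b) m (Option (n → ℤ)) where
  graph :=
    { Adj := fun v w => v ≠ w ∧ (v.1 = w.1 ∨ ∃ i, v.sign i * w.sign i = -1)
      symm := ⟨fun v w h => ⟨h.1.symm, h.2.imp Eq.symm fun ⟨i, hi⟩ => ⟨i, by rwa [mul_comm]⟩⟩⟩
      loopless := ⟨fun v h => h.1 rfl⟩ }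
  edgeColor := Sym2.lift ⟨fun v w =>
    if v.1 = w.1 then some (fun i => v.sign i * w.sign i) else none, by
      intro v w
      simp only [mul_comm, eq_comm]⟩
  vertexColor := fun v => v.1

/-- The incidence matrix `M_H` over `𝔽₂` of a graph `H`: rows indexed by the vertices, columns by
the edges. -/
def incidenceMatrix {V : Type} [DecidableEq V] (H : SimpleGraph V) :
    Matrix V H.edgeSet (ZMod 2) :=
  fun k e => if k ∈ e.1 then 1 else 0

/-- The complete bipartite graph `K_{3,4}`. -/
abbrev K34 : SimpleGraph (Fin 3 ⊕ Fin 4) := completeBipartiteGraph (Fin 3) (Fin 4)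

instance K34.instDecidableRelAdj : DecidableRel K34.Adj := fun v w =>
  inferInstanceAs (Decidable (v.isLeft ∧ w.isRight ∨ v.isRight ∧ w.isLeft))

/-- The colored graph `G_*(M_{K_{3,4}}, 0)`. -/
abbrev starGraphK34 :
    ColoredGraph (SolutionVertex (incidenceMatrix K34) 0) (Fin 3 ⊕ Fin 4)
      (Option (K34.edgeSet → ℤ)) :=
  starGraph (incidenceMatrix K34) 0

end LinearSystems

/-! ### The decolored graph of `K_{3,4}` -/

section Main

/-- The edge-colored graph `G_*'(M_{K_{3,4}}, 0)`: paths of lengths `n` are attached, and their edges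
have the color `-1`. -/
abbrev starGraphK34' (n : Fin 3 ⊕ Fin 4 → ℕ) :
    EdgeColoredGraph (PathVertex starGraphK34 n) (Option (K34.edgeSet → ℤ)) :=
  starGraphK34.attachPaths none n

/-- The vertices of `G_*''(M_{K_{3,4}}, 0)`. -/
abbrev StarVertexK34 (n : Fin 3 ⊕ Fin 4 → ℕ) (m : Option (K34.edgeSet → ℤ) → ℕ) : Type :=
  SubdivisionVertex (starGraphK34' n) none m

instance StarVertexK34.instFinite (n : Fin 3 ⊕ Fin 4 → ℕ)
    (m : Option (K34.edgeSet → ℤ) → ℕ) : Finite (StarVertexK34 n m) := by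
  classical
  have h₁ : Finite (PathVertex starGraphK34 n) := inferInstance
  have h₂ : Finite (Sym2 (PathVertex starGraphK34 n)) := inferInstance
  have h₃ : Finite ((starGraphK34' n).OtherEdge none) := inferInstance
  exact inferInstance

noncomputable instance StarVertexK34.instFintype (n : Fin 3 ⊕ Fin 4 → ℕ)
    (m : Option (K34.edgeSet → ℤ) → ℕ) : Fintype (StarVertexK34 n m) :=
  Fintype.ofFinite _

/-- The uncolored graph `G_*''(M_{K_{3,4}}, 0)`, where a path of length `n k` is attached to the
vertices of color `k`, the edges of every color `c ≠ -1` are subdivided, and a path of length `m c`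
is attached to the subdividing vertices. -/
abbrev starGraphK34'' (n : Fin 3 ⊕ Fin 4 → ℕ) (m : Option (K34.edgeSet → ℤ) → ℕ) :
    SimpleGraph (StarVertexK34 n m) :=
  (starGraphK34' n).subdivide none m

end Main

/-!
The relations of `C(Qut(G))` say that a magic unitary `u` respects adjacency, in the sense that
`u x y * u x' y' ≠ 0` forces `x ~ x' ↔ y ~ y'` (`IsQuantumAutomorphism.respects_adj`). The relations
on the vertices that `u` respects in this sense are closed under Boolean operations, composition,
transitive closure and counting (`IsMagicUnitary.respects_exists`, `respects_reflTransGen`,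
`respects_ncard`). The decolored graph consists of a subdivided graph with attached paths
(`ColoredGraph.pathAttachment`), and the ends of the paths, their lengths and the two kinds of
vertices of the subdivided graph can be described by degrees, connectedness and counting. Hence `u` is
determined by its restriction to the subdivided graph, and this restriction preserves all colors
(`isColorPreserving_root`).

A color-preserving magic unitary has entries `u (k, α) (k, β)` that depend only on the product of
`α` and `β`, so they are the joint spectral projections of commuting involutions `X k i`, one for each
edge `i` at the vertex `k` of `K_{3,4}`, with product `1`. Adjacency of vertices of different colors
forces `X k i = X l i` if `i` joins `k` and `l` (`IsColorPreserving.var_eq`). Thus the algebra is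
generated by a `3 × 4` grid of involutions in which every row and every column commutes and has
product `1`. If `a` and `b` are the first two rows, then the products of two entries of `a` commute
with the products of two entries of `b`, and with the conjugates of the latter by `a 0` they generate
a finite abelian group that `a 0` and `b 0` normalize. So the grid generates a finite-dimensional algebra
(`IsMagicGrid.exists_finiteDimensional`), which is closed and therefore all of `C(Qut(G))`.

Conversely, every such grid of self-adjoint unitaries gives a quantum automorphism: on the part of
the graph that belongs to the vertex `k` of `K_{3,4}`, it acts by the change of signs that is
distributed according to the joint spectral measure of the row or column `k`
(`PathAttachment.isQuantumAutomorphism_gridUnitary`). Two-qubit Pauli operators give a grid that is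
not commutative (`isPauliGrid_intMatrixHom`, `not_commute_intMatrixHom`), whence the quantum symmetry.
-/

/-! ### Magic unitaries and the relations they respect -/

section MagicUnitary

/-- A magic unitary over a ring: the entries of each row and of each column are orthogonal
idempotents with sum `1`. -/
structure IsMagicUnitary {W A : Type*} [Fintype W] [Ring A] (u : Matrix W W A) : Prop where
  idem : ∀ x y, u x y * u x y = u x y
  row_orth : ∀ x {y z}, y ≠ z → u x y * u x z = 0
  col_orth : ∀ y {x z}, x ≠ z → u x y * u z y = 0
  row_sum : ∀ x, ∑ y, u x y = 1
  col_sum : ∀ y, ∑ x, u x y = 1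

/-- A function `R` of two vertices is respected by `u` if it takes the same value at `(x, x')` and
at `(y, y')` whenever `u x y * u x' y' ≠ 0`. A function of one vertex is treated as a function
of two that ignores the second. -/
def Respects {W A T : Type*} [Ring A] (u : Matrix W W A) (R : W → W → T) : Prop :=
  ∀ ⦃x y x' y'⦄, u x y * u x' y' ≠ 0 → R x x' = R y y'

theorem IsStarProjection.mul_eq_zero_of_sum_eq_one {ι A : Type*} [Fintype ι] [CStarAlgebra A]
    {p : ι → A} (hp : ∀ i, IsStarProjection (p i)) (hsum : ∑ i, p i = 1) {i j : ι} (hij : i ≠ j) :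
    p i * p j = 0 := by
  classical
  let _ := CStarAlgebra.spectralOrder A
  have _ := CStarAlgebra.spectralOrderedRing A
  have hle : p j ≤ 1 - p i := by
    rw [← hsum, ← Finset.add_sum_erase _ _ (Finset.mem_univ i), add_sub_cancel_left]
    exact Finset.single_le_sum (f := p) (fun k _ => (hp k).nonneg) (by simp [hij.symm])
  have h := ((hp j).le_iff_mul_eq_right (hp i).one_sub).1 hle
  simpa [sub_mul] using h

theorem IsQuantumAutomorphism.isMagicUnitary {V : Type} [Fintype V] {G : SimpleGraph V}
    {A : Type*} [CStarAlgebra A] {u : Matrix V V A} (hu : IsQuantumAutomorphism G u) :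
    IsMagicUnitary u where
  idem x y := (hu.isStarProjection x y).isIdempotentElem
  row_orth x _ _ h := IsStarProjection.mul_eq_zero_of_sum_eq_one (p := fun y => u x y)
    (hu.isStarProjection x) (hu.row_sum x) h
  col_orth y _ _ h := IsStarProjection.mul_eq_zero_of_sum_eq_one (p := fun x => u x y)
    (fun x => hu.isStarProjection x y) (hu.col_sum y) h
  row_sum := hu.row_sum
  col_sum := hu.col_sum

/-- The intertwining relation with the adjacency matrix says that adjacency is respected. -/
theorem IsQuantumAutomorphism.respects_adj {V : Type} [Fintype V] {G : SimpleGraph V}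
    {A : Type*} [CStarAlgebra A] {u : Matrix V V A} (hu : IsQuantumAutomorphism G u) :
    Respects u G.Adj := by
  classical
  intro x y x' y' h
  have hm := hu.isMagicUnitary
  have h1 := congrFun (congrFun hu.adjMatrix_comm x) y'
  simp only [SimpleGraph.adjMatrix_mul_apply, SimpleGraph.mul_adjMatrix_apply] at h1
  have h2 := congrArg (fun a => u x y * a * u x' y') h1
  have hl : u x y * (∑ z ∈ G.neighborFinset x, u z y') * u x' y' =
      if G.Adj x x' then u x y * u x' y' else 0 := by
    rw [mul_assoc, Finset.sum_mul]
    have : ∀ z ∈ G.neighborFinset x, u z y' * u x' y' = if z = x' then u x' y' else 0 := by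
      intro z _
      split_ifs with hz
      · rw [hz, hm.idem]
      · exact hm.col_orth _ hz
    rw [Finset.sum_congr rfl this]
    simp
  have hr : u x y * (∑ z ∈ G.neighborFinset y', u x z) * u x' y' =
      if G.Adj y y' then u x y * u x' y' else 0 := by
    rw [Finset.mul_sum]
    have : ∀ z ∈ G.neighborFinset y', u x y * u x z = if z = y then u x y else 0 := by
      intro z _
      split_ifs with hz
      · rw [hz, hm.idem]
      · exact hm.row_orth _ (Ne.symm hz)
    rw [Finset.sum_congr rfl this]
    simp [SimpleGraph.adj_comm]
  simp only [hl, hr] at h2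
  by_cases ha : G.Adj x x' <;> by_cases hb : G.Adj y y' <;> simp_all

namespace IsMagicUnitary

variable {W A : Type*} [Fintype W] [Ring A] {u : Matrix W W A}

/-- A nonzero product stays nonzero after the insertion of a suitable entry of any given row. -/
theorem exists_right (hu : IsMagicUnitary u) {a b : A} (h : a * b ≠ 0) (z : W) :
    ∃ t, a * u z t ≠ 0 ∧ u z t * b ≠ 0 := by
  by_contra! hc
  refine h ?_
  rw [← mul_one a, ← hu.row_sum z, Finset.mul_sum, Finset.sum_mul]
  refine Finset.sum_eq_zero fun t _ => ?_
  by_cases h0 : a * u z t = 0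
  · rw [h0, zero_mul]
  · rw [mul_assoc, hc t h0, mul_zero]

/-- A nonzero product stays nonzero after the insertion of a suitable entry of any given column. -/
theorem exists_left (hu : IsMagicUnitary u) {a b : A} (h : a * b ≠ 0) (t : W) :
    ∃ z, a * u z t ≠ 0 ∧ u z t * b ≠ 0 := by
  by_contra! hc
  refine h ?_
  rw [← mul_one a, ← hu.col_sum t, Finset.mul_sum, Finset.sum_mul]
  refine Finset.sum_eq_zero fun z _ => ?_
  by_cases h0 : a * u z t = 0
  · rw [h0, zero_mul]
  · rw [mul_assoc, hc z h0, mul_zero]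

theorem mul_self_ne_zero (hu : IsMagicUnitary u) {x y : W} (h : u x y ≠ 0) :
    u x y * u x y ≠ 0 := by
  rwa [hu.idem]

theorem respects_eq (hu : IsMagicUnitary u) : Respects u (fun x y => x = y) := by
  intro x y x' y' h
  by_cases hx : x = x' <;> by_cases hy : y = y'
  · simp [hx, hy]
  · subst hx; exact (h (hu.row_orth x hy)).elim
  · subst hy; exact (h (hu.col_orth y hx)).elim
  · simp [hx, hy]

theorem respects_exists (hu : IsMagicUnitary u) {R S : W → W → Prop} (hR : Respects u R)
    (hS : Respects u S) : Respects u (fun x y => ∃ z, R x z ∧ S z y) := by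
  intro x y x' y' h
  refine propext ⟨?_, ?_⟩
  · rintro ⟨z, h1, h2⟩
    obtain ⟨t, h3, h4⟩ := hu.exists_right h z
    exact ⟨t, hR h3 ▸ h1, hS h4 ▸ h2⟩
  · rintro ⟨t, h1, h2⟩
    obtain ⟨z, h3, h4⟩ := hu.exists_left h t
    exact ⟨z, hR h3 ▸ h1, hS h4 ▸ h2⟩

theorem respects_reflTransGen (hu : IsMagicUnitary u) {R : W → W → Prop} (hR : Respects u R) :
    Respects u (Relation.ReflTransGen R) := by
  intro x y x' y' h
  refine propext ⟨fun hr => ?_, fun hr => ?_⟩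
  · induction hr generalizing y' with
    | refl => rw [(hu.respects_eq h).mp rfl]
    | @tail b c _ h2 ih =>
      obtain ⟨t, h3, h4⟩ := hu.exists_right h b
      exact (ih h3).tail (hR h4 ▸ h2)
  · induction hr generalizing x' with
    | refl => rw [(hu.respects_eq h).mpr rfl]
    | @tail b c _ h2 ih =>
      obtain ⟨t, h3, h4⟩ := hu.exists_left h b
      exact (ih h3).tail (hR h4 ▸ h2)

/-- The number of vertices in a respected relation to a given vertex is respected. Both sides of
`#{z | R x z} • u x y = #{t | R y t} • u x y` are the sum of all `u x y * u z t` with `R x z`, which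
is the same as `R y t` wherever the product does not vanish. -/
theorem respects_ncard (hu : IsMagicUnitary u) [Algebra ℂ A]
    {R : W → W → Prop}
    (hR : Respects u R) : Respects u (fun x _ => {z | R x z}.ncard) := by
  classical
  intro x y x' y' h
  have hxy : u x y ≠ 0 := left_ne_zero_of_mul h
  have key : ∑ z, ∑ t, (if R x z then u x y * u z t else 0) =
      ∑ z, ∑ t, (if R y t then u x y * u z t else 0) := by
    refine Finset.sum_congr rfl fun z _ => Finset.sum_congr rfl fun t _ => ?_
    by_cases h0 : u x y * u z t = 0
    · simp [h0]
    · rw [hR h0]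
  rw [Finset.sum_comm (f := fun z t => if R y t then u x y * u z t else 0)] at key
  have e1 : ∀ z, ∑ t, (if R x z then u x y * u z t else 0) = if R x z then u x y else 0 := by
    intro z
    split_ifs
    · rw [← Finset.mul_sum, hu.row_sum, mul_one]
    · simp
  have e2 : ∀ t, ∑ z, (if R y t then u x y * u z t else 0) = if R y t then u x y else 0 := by
    intro z
    split_ifs
    · rw [← Finset.mul_sum, hu.col_sum, mul_one]
    · simp
  simp only [e1, e2, ← Finset.sum_filter, Finset.sum_const] at key
  rw [← Nat.cast_smul_eq_nsmul ℂ, ← Nat.cast_smul_eq_nsmul ℂ] at key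
  have := Nat.cast_injective (smul_left_injective ℂ hxy key)
  change {z | R x z}.ncard = {z | R y z}.ncard
  rw [Set.ncard_eq_toFinset_card', Set.ncard_eq_toFinset_card']
  simpa using this

/-- Two entries agree if a respected relation pairs `x` with `x'` and pairs `y` and `y'` with
nothing but each other. -/
theorem eq_of_respects (hu : IsMagicUnitary u) {R : W → W → Prop} (hR : Respects u R)
    {x y x' y' : W} (hx : R x x') (h1 : ∀ t, R y t → t = y') (h2 : ∀ t, R t y' → t = y) :
    u x y = u x' y' := by
  have e1 : u x y = u x y * u x' y' := by
    conv_lhs => rw [← mul_one (u x y), ← hu.row_sum x', Finset.mul_sum]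
    refine Finset.sum_eq_single y' (fun t _ ht => ?_) (by simp)
    by_contra h0
    exact ht (h1 t ((hR h0).mp hx))
  have e2 : u x' y' = u x y * u x' y' := by
    conv_lhs => rw [← one_mul (u x' y'), ← hu.row_sum x, Finset.sum_mul]
    refine Finset.sum_eq_single y (fun t _ ht => ?_) (by simp)
    by_contra h0
    exact ht (h2 t ((hR h0).mp hx))
  rw [e1, ← e2]

end IsMagicUnitary

namespace Respects

variable {W A T T' : Type*} [Ring A] {u : Matrix W W A}

theorem comp {R : W → W → T} (hR : Respects u R) (f : T → T') :
    Respects u (fun x y => f (R x y)) :=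
  fun _ _ _ _ h => congrArg f (hR h)

theorem map₂ {T'' : Type*} {R : W → W → T} {S : W → W → T'} (hR : Respects u R)
    (hS : Respects u S) (f : T → T' → T'') : Respects u (fun x y => f (R x y) (S x y)) :=
  fun _ _ _ _ h => congrArg₂ f (hR h) (hS h)

theorem const (c : T) : Respects u (fun _ _ => c) :=
  fun _ _ _ _ _ => rfl

theorem eq_of_ne_zero [Fintype W] (hu : IsMagicUnitary u) {P : W → T}
    (hP : Respects u (fun x _ => P x)) {x y : W} (h : u x y ≠ 0) : P x = P y :=
  hP (hu.mul_self_ne_zero h)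

theorem of_eq_of_ne_zero {P : W → T}
    (hP : ∀ x y, u x y ≠ 0 → P x = P y) : Respects u (fun x _ => P x) :=
  fun _ _ _ _ h => hP _ _ (left_ne_zero_of_mul h)

theorem snd [Fintype W] (hu : IsMagicUnitary u) {P : W → T} (hP : Respects u (fun x _ => P x)) :
    Respects u (fun _ y => P y) :=
  fun _ _ _ _ h => eq_of_ne_zero hu hP (right_ne_zero_of_mul h)

end Respects

end MagicUnitary

/-! ### Attached paths -/

section PathAttachment

/-- A presentation of `G` as the graph obtained from `K` by attaching a path of length `len b` to
each vertex `b`: every vertex of `G` is given by its base vertex and by its distance to it. -/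
structure PathAttachment {W B : Type*} (G : SimpleGraph W) (K : SimpleGraph B)
    (len : B → ℕ) where
  base : W → B
  level : W → ℕ
  level_le : ∀ x, level x ≤ len (base x)
  ext : ∀ {x y}, base x = base y → level x = level y → x = y
  exists_eq : ∀ b i, i ≤ len b → ∃ x, base x = b ∧ level x = i
  adj_iff : ∀ x y, G.Adj x y ↔ (level x = 0 ∧ level y = 0 ∧ K.Adj (base x) (base y)) ∨
    (base x = base y ∧ (level x + 1 = level y ∨ level y + 1 = level x))

namespace PathAttachment

variable {W B : Type*} {G : SimpleGraph W} {K : SimpleGraph B} {len : B → ℕ}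

/-- The vertex of `G` that corresponds to the vertex `b` of `K`. -/
noncomputable def root (P : PathAttachment G K len) (b : B) : W :=
  (P.exists_eq b 0 (Nat.zero_le _)).choose

@[simp] theorem base_root (P : PathAttachment G K len) (b : B) : P.base (P.root b) = b :=
  (P.exists_eq b 0 (Nat.zero_le _)).choose_spec.1

@[simp] theorem level_root (P : PathAttachment G K len) (b : B) : P.level (P.root b) = 0 :=
  (P.exists_eq b 0 (Nat.zero_le _)).choose_spec.2

theorem root_base (P : PathAttachment G K len) {x : W} (h : P.level x = 0) :
    P.root (P.base x) = x :=
  P.ext (by simp) (by simp [h])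

theorem root_injective (P : PathAttachment G K len) : Function.Injective P.root :=
  Function.LeftInverse.injective P.base_root

theorem adj_root (P : PathAttachment G K len) (b c : B) :
    G.Adj (P.root b) (P.root c) ↔ K.Adj b c := by
  simp [P.adj_iff]

theorem ncard_base_eq (P : PathAttachment G K len) (b : B) :
    {y | P.base y = b}.ncard = len b + 1 := by
  have hi : Set.InjOn P.level {y | P.base y = b} := fun x hx y hy h => P.ext (hx.trans hy.symm) h
  rw [← hi.ncard_image]
  have : P.level '' {y | P.base y = b} = (Finset.range (len b + 1) : Set ℕ) := by
    ext i
    simp only [Set.mem_image, Set.mem_ofPred_eq, Finset.coe_range, Set.mem_Iio]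
    constructor
    · rintro ⟨x, rfl, rfl⟩
      exact Nat.lt_succ_of_le (P.level_le x)
    · intro h
      exact P.exists_eq b i (Nat.le_of_lt_succ h)
  rw [this, Set.ncard_coe_finset, Finset.card_range]

theorem ncard_adj_le_two (P : PathAttachment G K len) {x : W} (hx : P.level x ≠ 0) :
    {y | G.Adj x y}.ncard ≤ 2 := by
  have hb : ∀ y, G.Adj x y → P.base y = P.base x ∧
      (P.level y = P.level x - 1 ∨ P.level y = P.level x + 1) := by
    intro y hy
    rcases (P.adj_iff x y).1 hy with h | ⟨h, h'⟩
    · exact (hx h.1).elim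
    · exact ⟨h.symm, by omega⟩
  refine (Set.ncard_le_ncard_of_injOn P.level (t := {P.level x - 1, P.level x + 1})
    (fun y hy => ?_) (fun y hy z hz h => ?_) (Set.toFinite _)).trans
    ((Set.ncard_insert_le _ _).trans (by simp))
  · simpa using (hb y hy).2
  · exact P.ext ((hb y hy).1.trans (hb z hz).1.symm) h

theorem ncard_adj_le [Finite B] (P : PathAttachment G K len) (x : W) (hx : P.level x = 0) :
    {y | G.Adj x y}.ncard ≤ {b | K.Adj (P.base x) b}.ncard + 1 := by
  classical
  have hb : ∀ y, G.Adj x y → (P.level y = 0 ∧ K.Adj (P.base x) (P.base y)) ∨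
      (P.level y = 1 ∧ P.base y = P.base x) := by
    intro y hy
    rcases (P.adj_iff x y).1 hy with h | ⟨h, h'⟩
    · exact Or.inl h.2
    · exact Or.inr ⟨by omega, h.symm⟩
  refine (Set.ncard_le_ncard_of_injOn (fun y => if P.level y = 0 then some (P.base y) else none)
    (t := insert none (some '' {b | K.Adj (P.base x) b}))
    (fun y hy => ?_) (fun y hy z hz h => ?_) (Set.toFinite _)).trans
    ((Set.ncard_insert_le _ _).trans ?_)
  · rcases hb y hy with h | h
    · simp [h.1, h.2]
    · simp [h.1]
  · rcases hb y hy with h1 | h1 <;> rcases hb z hz with h2 | h2 <;> simp [h1.1, h2.1] at h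
    · exact P.ext h (h1.1.trans h2.1.symm)
    · exact P.ext (h1.2.trans h2.2.symm) (h1.1.trans h2.1.symm)
  · rw [Set.ncard_image_of_injective _ (Option.some_injective _)]

theorem le_ncard_adj [Finite W] (P : PathAttachment G K len) (b : B) :
    {c | K.Adj b c}.ncard ≤ {y | G.Adj (P.root b) y}.ncard :=
  Set.ncard_le_ncard_of_injOn P.root (fun c hc => (P.adj_root b c).2 hc)
    P.root_injective.injOn (Set.toFinite _)

end PathAttachment

end PathAttachment

/-! ### Recovering the base graph from the graph with attached paths -/

section Recovery

/-- The two kinds of base vertices of a decolored graph are told apart by their degrees: the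
original vertices have at least four neighbors, the subdividing vertices exactly two, and those
are original. -/
structure IsSubdivisionGraph {V E : Type*} (K : SimpleGraph (V ⊕ E)) : Prop where
  four_le_ncard : ∀ v, 4 ≤ {b | K.Adj (Sum.inl v) b}.ncard
  ncard_eq_two : ∀ e, {b | K.Adj (Sum.inr e) b}.ncard = 2
  isLeft_of_adj : ∀ {e b}, K.Adj (Sum.inr e) b → b.isLeft

namespace PathAttachment

variable {W V E : Type*} {G : SimpleGraph W} {K : SimpleGraph (V ⊕ E)} {len : V ⊕ E → ℕ}

/-- Degree at least four characterizes the original vertices. -/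
theorem four_le_ncard_adj_iff [Finite W] [Finite V] [Finite E] (P : PathAttachment G K len)
    (hK : IsSubdivisionGraph K) (x : W) :
    4 ≤ {y | G.Adj x y}.ncard ↔ P.level x = 0 ∧ (P.base x).isLeft := by
  constructor
  · intro h
    by_cases hx : P.level x = 0
    · refine ⟨hx, ?_⟩
      have h1 := P.ncard_adj_le x hx
      cases hb : P.base x with
      | inl v => rfl
      | inr e =>
        rw [hb, hK.ncard_eq_two] at h1
        omega
    · have := P.ncard_adj_le_two hx
      omega
  · rintro ⟨hx, hb⟩
    obtain ⟨v, hv⟩ := Sum.isLeft_iff.1 hb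
    have h1 := P.le_ncard_adj (P.base x)
    rw [P.root_base hx, hv] at h1
    exact (hK.four_le_ncard v).trans h1

/-- The vertices of the base graph are the original vertices and those with two original
neighbors. A vertex inside an attached path has at most one. -/
theorem level_eq_zero_iff [Finite W] [Finite V] [Finite E] (P : PathAttachment G K len)
    (hK : IsSubdivisionGraph K) (x : W) :
    P.level x = 0 ↔ 4 ≤ {y | G.Adj x y}.ncard ∨
      2 ≤ {y | G.Adj x y ∧ 4 ≤ {z | G.Adj y z}.ncard}.ncard := by
  simp only [P.four_le_ncard_adj_iff hK]
  constructor
  · intro hx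
    cases hb : P.base x with
    | inl v => exact Or.inl ⟨hx, rfl⟩
    | inr e =>
      refine Or.inr ?_
      rw [← hK.ncard_eq_two e, ← P.root_base hx, hb]
      exact Set.ncard_le_ncard_of_injOn P.root
        (fun b hb => ⟨(P.adj_root _ _).2 hb, by simp, by simpa using hK.isLeft_of_adj hb⟩)
        P.root_injective.injOn (Set.toFinite _)
  · rintro (h | h)
    · exact h.1
    · by_contra hx
      have : {y | G.Adj x y ∧ P.level y = 0 ∧ (P.base y).isLeft} ⊆ {P.root (P.base x)} := by
        rintro y ⟨h1, h2, -⟩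
        rcases (P.adj_iff x y).1 h1 with h3 | ⟨h3, -⟩
        · exact (hx h3.1).elim
        · rw [h3]
          exact (P.root_base h2).symm
      have := Set.ncard_le_ncard this (Set.toFinite _)
      rw [Set.ncard_singleton] at this
      omega

/-- Two vertices lie on the same attached path if and only if they are connected by edges that do
not join two vertices of the base graph. -/
theorem base_eq_iff (P : PathAttachment G K len) (x y : W) :
    P.base x = P.base y ↔
      Relation.ReflTransGen (fun x y => G.Adj x y ∧ ¬(P.level x = 0 ∧ P.level y = 0)) x y := by
  constructor
  · have key : ∀ k x, P.level x = k → Relation.ReflTransGen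
        (fun x y => G.Adj x y ∧ ¬(P.level x = 0 ∧ P.level y = 0)) (P.root (P.base x)) x := by
      intro k
      induction k with
      | zero => intro x hx; rw [P.root_base hx]
      | succ k ih =>
        intro x hx
        obtain ⟨z, hz, hk⟩ := P.exists_eq (P.base x) k (by have := P.level_le x; omega)
        have := ih z hk
        rw [hz] at this
        refine this.tail ⟨(P.adj_iff z x).2 (Or.inr ⟨hz, Or.inl (by omega)⟩), by omega⟩
    intro h
    have h1 := key _ x rfl
    have h2 := key _ y rfl
    rw [h] at h1
    have hsymm : Std.Symm (fun x y => G.Adj x y ∧ ¬(P.level x = 0 ∧ P.level y = 0)) :=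
      ⟨fun a b hab => ⟨hab.1.symm, fun hc => hab.2 hc.symm⟩⟩
    exact (Relation.ReflTransGen.stdSymm.symm _ _ h1).trans h2
  · intro h
    induction h with
    | refl => rfl
    | tail _ h ih =>
      rcases (P.adj_iff _ _).1 h.1 with h1 | h1
      · exact (h.2 ⟨h1.1, h1.2.1⟩).elim
      · exact ih.trans h1.1

section Respects

variable [Fintype W] [Finite V] [Finite E] {A : Type*} [Ring A] [Algebra ℂ A]
  {u : Matrix W W A}

theorem respects_root (P : PathAttachment G K len) (hK : IsSubdivisionGraph K)
    (hu : IsMagicUnitary u) (hG : Respects u G.Adj) :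
    Respects u (fun x _ => P.level x = 0) := by
  have h1 : Respects u (fun x _ => 4 ≤ {y | G.Adj x y}.ncard) :=
    (hu.respects_ncard hG).comp (4 ≤ ·)
  have h2 : Respects u (fun x _ => 2 ≤ {y | G.Adj x y ∧ 4 ≤ {z | G.Adj y z}.ncard}.ncard) :=
    (hu.respects_ncard (hG.map₂ (h1.snd hu) And)).comp (2 ≤ ·)
  have h3 := h1.map₂ h2 Or
  simpa only [← P.level_eq_zero_iff hK] using h3

theorem respects_base (P : PathAttachment G K len) (hK : IsSubdivisionGraph K)
    (hu : IsMagicUnitary u) (hG : Respects u G.Adj) :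
    Respects u (fun x y => P.base x = P.base y) := by
  have h1 := P.respects_root hK hu hG
  have h2 := hu.respects_reflTransGen
    (hG.map₂ (h1.map₂ (h1.snd hu) (fun p q => ¬(p ∧ q))) And)
  exact (congrArg (Respects u) (funext₂ fun x y => propext (P.base_eq_iff x y))).mpr h2

theorem respects_isLeft (P : PathAttachment G K len) (hK : IsSubdivisionGraph K)
    (hu : IsMagicUnitary u) (hG : Respects u G.Adj) :
    Respects u (fun x _ => ((P.base x).isLeft : Prop)) := by
  have h1 : Respects u (fun x _ => 4 ≤ {y | G.Adj x y}.ncard) :=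
    (hu.respects_ncard hG).comp (4 ≤ ·)
  simp only [P.four_le_ncard_adj_iff hK] at h1
  have h2 := hu.respects_exists ((P.respects_base hK hu hG).map₂ (h1.snd hu) And)
    (Respects.const (u := u) True)
  refine (congrArg (Respects u) ?_).mp h2
  funext x y
  refine propext ⟨?_, fun h => ⟨P.root (P.base x), by simpa using h⟩⟩
  rintro ⟨z, ⟨h3, -, h4⟩, -⟩
  rwa [h3]

/-- The length of a path is determined by the number of its vertices. -/
theorem respects_len (P : PathAttachment G K len) (hK : IsSubdivisionGraph K)
    (hu : IsMagicUnitary u) (hG : Respects u G.Adj) :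
    Respects u (fun x _ => len (P.base x)) := by
  have h1 := (hu.respects_ncard (P.respects_base hK hu hG)).comp (· - 1)
  have : ∀ x, {z | P.base x = P.base z}.ncard - 1 = len (P.base x) := by
    intro x
    rw [← Nat.add_sub_cancel (len (P.base x)) 1, ← P.ncard_base_eq]
    simp only [eq_comm]
  simpa only [this] using h1

theorem respects_level_le (P : PathAttachment G K len) (hK : IsSubdivisionGraph K)
    (hu : IsMagicUnitary u) (hG : Respects u G.Adj) (i : ℕ) :
    Respects u (fun x _ => P.level x ≤ i) := by
  induction i with
  | zero => simpa using P.respects_root hK hu hG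
  | succ i ih =>
    have h2 := (hu.respects_exists
      ((hG.map₂ (P.respects_base hK hu hG) And).map₂ (ih.snd hu) And)
      (Respects.const (u := u) True)).map₂ ih Or
    refine (congrArg (Respects u) ?_).mp h2
    funext x y
    refine propext ⟨?_, fun h => ?_⟩
    · rintro (⟨z, ⟨⟨h3, h4⟩, h5⟩, -⟩ | h)
      · rcases (P.adj_iff x z).1 h3 with h6 | h6 <;> omega
      · omega
    · by_cases hx : P.level x ≤ i
      · exact Or.inr hx
      · obtain ⟨z, hz, hi⟩ := P.exists_eq (P.base x) i (by have := P.level_le x; omega)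
        exact Or.inl ⟨z, ⟨⟨(P.adj_iff x z).2 (Or.inr ⟨hz.symm, by omega⟩), hz.symm⟩, hi.le⟩,
          trivial⟩

theorem respects_level (P : PathAttachment G K len) (hK : IsSubdivisionGraph K)
    (hu : IsMagicUnitary u) (hG : Respects u G.Adj) :
    Respects u (fun x _ => P.level x) := by
  intro x y x' y' h
  have h1 := (P.respects_level_le hK hu hG (P.level x) h).mp le_rfl
  have h2 := (P.respects_level_le hK hu hG (P.level y) h).mpr le_rfl
  exact le_antisymm h2 h1

theorem apply_eq_zero_of_level_ne (P : PathAttachment G K len) (hK : IsSubdivisionGraph K)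
    (hu : IsMagicUnitary u) (hG : Respects u G.Adj) {x y : W} (h : P.level x ≠ P.level y) :
    u x y = 0 := by
  by_contra h0
  exact h ((P.respects_level hK hu hG).eq_of_ne_zero hu h0)

/-- Along the attached paths the entries of `u` are constant. -/
theorem apply_eq_apply_root (P : PathAttachment G K len) (hK : IsSubdivisionGraph K)
    (hu : IsMagicUnitary u) (hG : Respects u G.Adj) {x y : W} (h : P.level x = P.level y) :
    u x y = u (P.root (P.base x)) (P.root (P.base y)) := by
  have hl := P.respects_level hK hu hG
  refine hu.eq_of_respects (R := fun a b => P.base a = P.base b ∧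
      (P.level a = P.level x ∧ P.level b = 0))
    ((P.respects_base hK hu hG).map₂
      ((hl.comp (· = P.level x)).map₂ ((hl.snd hu).comp (· = 0)) And) And)
    ⟨by simp, rfl, by simp⟩ ?_ ?_
  · rintro t ⟨h1, -, h2⟩
    exact P.ext (by simp [h1]) (by simp [h2])
  · rintro t ⟨h1, h2, -⟩
    exact P.ext (by simpa using h1) (h2.trans h)

variable [Fintype V] [Fintype E]

/-- The restriction of `u` to the base graph is again a magic unitary. -/
theorem isMagicUnitary_root (P : PathAttachment G K len) (hK : IsSubdivisionGraph K)
    (hu : IsMagicUnitary u) (hG : Respects u G.Adj) :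
    IsMagicUnitary (fun b c => u (P.root b) (P.root c)) where
  idem _ _ := hu.idem _ _
  row_orth _ _ _ h := hu.row_orth _ (P.root_injective.ne h)
  col_orth _ _ _ h := hu.col_orth _ (P.root_injective.ne h)
  row_sum b := by
    rw [← hu.row_sum (P.root b)]
    refine Fintype.sum_of_injective P.root P.root_injective _ _ (fun y hy => ?_) (fun _ => rfl)
    refine P.apply_eq_zero_of_level_ne hK hu hG fun h => hy ⟨P.base y, P.root_base ?_⟩
    simpa using h.symm
  col_sum b := by
    rw [← hu.col_sum (P.root b)]
    refine Fintype.sum_of_injective P.root P.root_injective _ _ (fun y hy => ?_) (fun _ => rfl)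
    refine P.apply_eq_zero_of_level_ne hK hu hG fun h => hy ⟨P.base y, P.root_base ?_⟩
    simpa using h

end Respects

end PathAttachment

end Recovery

/-! ### Decolored graphs as graphs with attached paths -/

section Decolored

/-- The subdivision of the edges of color different from `c₀`, without attached paths. -/
def EdgeColoredGraph.subdivided {V T : Type} (G : EdgeColoredGraph V T) (c₀ : T) :
    SimpleGraph (V ⊕ G.OtherEdge c₀) where
  Adj
    | .inl v, .inl w => G.graph.Adj v w ∧ G.edgeColor s(v, w) = c₀
    | .inl v, .inr e => v ∈ e.1
    | .inr e, .inl v => v ∈ e.1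
    | .inr _, .inr _ => False
  symm := ⟨by
    rintro (v | x) (w | y) h
    · exact ⟨h.1.symm, by rw [Sym2.eq_swap]; exact h.2⟩
    · exact h
    · exact h
    · exact h⟩
  loopless := ⟨by
    rintro (v | x) h
    · exact G.graph.loopless.irrefl _ h.1
    · exact h⟩

variable {V S T : Type} (G : ColoredGraph V S T) (c₀ : T)

/-- The lengths of the paths attached to the original and to the subdividing vertices. -/
def ColoredGraph.pathLength (n : S → ℕ) (m : T → ℕ) :
    V ⊕ G.toEdgeColoredGraph.OtherEdge c₀ → ℕ :=
  Sum.elim (fun v => n (G.vertexColor v)) (fun e => m (G.edgeColor e.1))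

variable {G c₀}

/-- Only the edges between vertices of level `0` are subdivided. -/
theorem ColoredGraph.exists_of_otherEdge {n : S → ℕ} (e : (G.attachPaths c₀ n).OtherEdge c₀) :
    ∃ v w : V, e.1 = s(⟨v, 0⟩, ⟨w, 0⟩) ∧ G.graph.Adj v w ∧ G.edgeColor s(v, w) ≠ c₀ ∧
      (G.attachPaths c₀ n).edgeColor e.1 = G.edgeColor s(v, w) := by
  obtain ⟨e, he, hc⟩ := e
  induction e using Sym2.ind with
  | _ x y =>
    obtain ⟨v, i⟩ := x
    obtain ⟨w, j⟩ := y
    simp only [ColoredGraph.attachPaths, Sym2.lift_mk] at hc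
    by_cases h : i.val = 0 ∧ j.val = 0
    · obtain ⟨hi, hj⟩ := h
      obtain rfl : i = 0 := Fin.ext hi
      obtain rfl : j = 0 := Fin.ext hj
      refine ⟨v, w, rfl, ?_, by simpa using hc, by simp [ColoredGraph.attachPaths]⟩
      rcases he with h1 | ⟨-, h1⟩
      · exact h1.2.2
      · simp at h1
    · rw [if_neg h] at hc
      exact (hc rfl).elim

theorem ColoredGraph.map_mem_otherEdge {n : S → ℕ} (e : (G.attachPaths c₀ n).OtherEdge c₀) :
    e.1.map Sigma.fst ∈ G.graph.edgeSet ∧ G.edgeColor (e.1.map Sigma.fst) ≠ c₀ := by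
  obtain ⟨v, w, he, h1, h2, -⟩ := exists_of_otherEdge e
  rw [he]
  exact ⟨h1, h2⟩

theorem ColoredGraph.edgeColor_otherEdge {n : S → ℕ} (e : (G.attachPaths c₀ n).OtherEdge c₀) :
    (G.attachPaths c₀ n).edgeColor e.1 = G.edgeColor (e.1.map Sigma.fst) := by
  obtain ⟨v, w, he, h1, h2, h3⟩ := exists_of_otherEdge e
  rw [h3, he]
  rfl

theorem ColoredGraph.mem_otherEdge_iff {n : S → ℕ} (e : (G.attachPaths c₀ n).OtherEdge c₀)
    (x : PathVertex G n) : x ∈ e.1 ↔ x.2.val = 0 ∧ x.1 ∈ e.1.map Sigma.fst := by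
  obtain ⟨v, w, he, -⟩ := exists_of_otherEdge e
  obtain ⟨x, i⟩ := x
  rw [he]
  simp only [Sym2.mem_iff, Sym2.map_mk]
  constructor
  · rintro (h | h) <;> cases h <;> simp
  · rintro ⟨hi, rfl | rfl⟩
    · left; congr 1; exact Fin.ext hi
    · right; congr 1; exact Fin.ext hi

theorem ColoredGraph.map_otherEdge_injective {n : S → ℕ}
    {e f : (G.attachPaths c₀ n).OtherEdge c₀} (h : e.1.map Sigma.fst = f.1.map Sigma.fst) :
    e = f := by
  refine Subtype.ext (Sym2.ext fun x => ?_)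
  rw [mem_otherEdge_iff, mem_otherEdge_iff, h]

/-- The decolored graph `G''` arises from the subdivision of `G` by attaching paths. -/
def ColoredGraph.pathAttachment (G : ColoredGraph V S T) (c₀ : T) (n : S → ℕ) (m : T → ℕ) :
    PathAttachment ((G.attachPaths c₀ n).subdivide c₀ m)
      (G.toEdgeColoredGraph.subdivided c₀) (G.pathLength c₀ n m) where
  base := Sum.map Sigma.fst (fun x => ⟨x.1.1.map Sigma.fst, map_mem_otherEdge x.1⟩)
  level := Sum.elim (fun x => x.2.val) (fun x => x.2.val)
  level_le := by
    rintro (x | x)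
    · exact Nat.le_of_lt_succ x.2.2
    · refine (Nat.le_of_lt_succ x.2.2).trans ?_
      rw [edgeColor_otherEdge]
      rfl
  ext := by
    rintro (⟨v, i⟩ | ⟨e, i⟩) (⟨w, j⟩ | ⟨f, j⟩) h1 h2
    · simp only [Sum.map_inl, Sum.inl.injEq] at h1
      subst h1
      obtain rfl : i = j := Fin.ext h2
      rfl
    · simp at h1
    · simp at h1
    · simp only [Sum.map_inr, Sum.inr.injEq, Subtype.mk.injEq] at h1
      obtain rfl := map_otherEdge_injective h1
      obtain rfl : i = j := Fin.ext h2
      rfl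
  exists_eq := by
    rintro (v | ⟨e, he⟩) i hi
    · exact ⟨Sum.inl ⟨v, i, Nat.lt_succ_of_le hi⟩, rfl, rfl⟩
    · induction e using Sym2.ind with
      | _ v w =>
        have hf : s((⟨v, 0⟩ : PathVertex G n), ⟨w, 0⟩) ∈ (G.attachPaths c₀ n).graph.edgeSet ∧
            (G.attachPaths c₀ n).edgeColor s(⟨v, 0⟩, ⟨w, 0⟩) ≠ c₀ :=
          ⟨Or.inl ⟨rfl, rfl, he.1⟩, by simpa [ColoredGraph.attachPaths] using he.2⟩
        refine ⟨Sum.inr ⟨⟨_, hf⟩, i, Nat.lt_succ_of_le ?_⟩, rfl, rfl⟩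
        simpa [ColoredGraph.attachPaths, ColoredGraph.pathLength] using hi
  adj_iff := by
    rintro (x | x) (y | y)
    · change ((_ ∧ _ ∧ _) ∨ _) ∧ (if x.2.val = 0 ∧ y.2.val = 0 then _ else _) = _ ↔
        (x.2.val = 0 ∧ y.2.val = 0 ∧ G.graph.Adj x.1 y.1 ∧ G.edgeColor s(x.1, y.1) = c₀) ∨
        ((Sum.inl x.1 : V ⊕ G.toEdgeColoredGraph.OtherEdge c₀) = Sum.inl y.1 ∧ _)
      rw [Sum.inl.injEq]
      split_ifs with h
      · have h0 : ¬ (x.2.val + 1 = y.2.val ∨ y.2.val + 1 = x.2.val) := by omega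
        tauto
      · tauto
    · change x ∈ y.1.1 ∧ y.2.val = 0 ↔ (x.2.val = 0 ∧ y.2.val = 0 ∧ x.1 ∈ y.1.1.map Sigma.fst) ∨ _
      rw [mem_otherEdge_iff]
      simp only [Sum.map_inl, Sum.map_inr, reduceCtorEq, false_and, or_false]
      tauto
    · change y ∈ x.1.1 ∧ x.2.val = 0 ↔ (x.2.val = 0 ∧ y.2.val = 0 ∧ y.1 ∈ x.1.1.map Sigma.fst) ∨ _
      rw [mem_otherEdge_iff]
      simp only [Sum.map_inl, Sum.map_inr, reduceCtorEq, false_and, or_false]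
      tauto
    · change x.1 = y.1 ∧ (x.2.val + 1 = y.2.val ∨ y.2.val + 1 = x.2.val) ↔
        (x.2.val = 0 ∧ y.2.val = 0 ∧ False) ∨ (_ ∧ (x.2.val + 1 = y.2.val ∨ y.2.val + 1 = x.2.val))
      simp only [Sum.map_inr, Sum.inr.injEq, Subtype.mk.injEq, and_false, false_or]
      exact and_congr_left fun _ => ⟨fun h => by rw [h], map_otherEdge_injective⟩

end Decolored

/-! ### Signs of the vertices of the graph of a linear system -/

section Signs

namespace SolutionVertex

variable {m n : Type} [Fintype n] {M : Matrix m n (ZMod 2)} {b : m → ZMod 2}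

theorem sign_of_eq (v : SolutionVertex M b) {i : n} (h : M v.1 i = 1) :
    v.sign i = (v.2.1 ⟨i, h⟩ : ℤ) :=
  dif_pos h

theorem sign_of_ne (v : SolutionVertex M b) {i : n} (h : M v.1 i ≠ 1) : v.sign i = 0 :=
  dif_neg h

theorem sign_mul_self (v : SolutionVertex M b) {i : n} (h : M v.1 i = 1) :
    v.sign i * v.sign i = 1 := by
  rw [v.sign_of_eq h, ← Units.val_mul, Int.units_mul_self, Units.val_one]

theorem sign_eq_or (v : SolutionVertex M b) {i : n} (h : M v.1 i = 1) :
    v.sign i = 1 ∨ v.sign i = -1 :=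
  mul_self_eq_one_iff.1 (v.sign_mul_self h)

theorem ext_sign {v w : SolutionVertex M b} (h : v.1 = w.1)
    (hs : ∀ i, M v.1 i = 1 → v.sign i = w.sign i) : v = w := by
  obtain ⟨k, α, hα⟩ := v
  obtain ⟨l, β, hβ⟩ := w
  obtain rfl : k = l := h
  have : α = β := by
    funext i
    have h1 := hs i.1 i.2
    rw [sign_of_eq _ i.2, sign_of_eq _ i.2] at h1
    exact Units.ext h1
  subst this
  rfl

/-- The vertex with the values `α_i γ_i`, for a function `γ` with product `1` on `S_k`. -/
def twist (v : SolutionVertex M b) (γ : n → ℤˣ) (h : ∏ i : {i // M v.1 i = 1}, γ i.1 = 1) :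
    SolutionVertex M b :=
  ⟨v.1, fun i => v.2.1 i * γ i.1, by rw [Finset.prod_mul_distrib, h, mul_one, v.2.2]⟩

theorem sign_twist (v : SolutionVertex M b) (γ : n → ℤˣ)
    (h : ∏ i : {i // M v.1 i = 1}, γ i.1 = 1) (i : n) :
    (v.twist γ h).sign i = v.sign i * γ i := by
  by_cases hi : M v.1 i = 1
  · rw [sign_of_eq _ hi, sign_of_eq (v.twist γ h) (i := i) hi]
    simp [twist]
  · rw [sign_of_ne _ hi, sign_of_ne (v.twist γ h) (i := i) hi, zero_mul]

/-- Three vertices for the same equation have a product. -/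
theorem exists_sign_mul (v w x : SolutionVertex M b) (hw : w.1 = v.1) (hx : x.1 = v.1) :
    ∃ y : SolutionVertex M b, y.1 = v.1 ∧ ∀ i, y.sign i = v.sign i * w.sign i * x.sign i := by
  obtain ⟨k, α, hα⟩ := v
  obtain ⟨l, β, hβ⟩ := w
  obtain ⟨l', δ, hδ⟩ := x
  obtain rfl : l = k := hw
  obtain rfl : l' = l := hx
  refine ⟨⟨l', fun i => α i * β i * δ i, ?_⟩, rfl, fun i => ?_⟩
  · rw [Finset.prod_mul_distrib, Finset.prod_mul_distrib, hα, hβ, hδ]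
    split_ifs <;> simp
  · by_cases hi : M l' i = 1
    · rw [sign_of_eq _ (i := i) hi, sign_of_eq _ (i := i) hi, sign_of_eq _ (i := i) hi,
        sign_of_eq _ (i := i) hi]
      simp
    · rw [sign_of_ne _ (i := i) hi, sign_of_ne _ (i := i) hi, zero_mul, zero_mul]

/-- The vertex `(k, 1)` of the graph of a homogeneous system. -/
def one (M : Matrix m n (ZMod 2)) (k : m) : SolutionVertex M 0 :=
  ⟨k, 1, by simp⟩

theorem sign_one {k : m} {i : n} (h : M k i = 1) : (one M k).sign i = 1 := by
  rw [sign_of_eq (one M k) (i := i) h]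
  rfl

/-- Changing the signs at two positions. -/
theorem exists_flip [DecidableEq n] (v : SolutionVertex M b) {i j : n} (hi : M v.1 i = 1)
    (hj : M v.1 j = 1) (hij : i ≠ j) :
    ∃ w : SolutionVertex M b, w.1 = v.1 ∧ w.sign i = - v.sign i := by
  refine ⟨v.twist (Pi.mulSingle i (-1) * Pi.mulSingle j (-1)) ?_, rfl, ?_⟩
  · have key : ∀ i', M v.1 i' = 1 →
        ∏ x : {x // M v.1 x = 1}, (Pi.mulSingle i' (-1) : n → ℤˣ) x.1 = -1 := by
      intro i' hi'
      rw [Finset.prod_eq_single (⟨i', hi'⟩ : {x // M v.1 x = 1})]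
      · simp
      · intro x _ hx
        exact Pi.mulSingle_eq_of_ne (fun h => hx (Subtype.ext h)) _
      · simp
    simp only [Pi.mul_apply, Finset.prod_mul_distrib, key i hi, key j hj]
    simp
  · rw [sign_twist]
    simp [Pi.mulSingle_eq_of_ne hij]

end SolutionVertex

end Signs

/-! ### The edges of `K_{3,4}` -/

section EdgesOfK34

/-- The edge of `K_{3,4}` between `r` and `j`. -/
def edgeK34 (r : Fin 3) (j : Fin 4) : K34.edgeSet :=
  ⟨s(Sum.inl r, Sum.inr j), by simp⟩

theorem exists_edgeK34 (e : K34.edgeSet) : ∃ r j, e = edgeK34 r j := by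
  obtain ⟨e, he⟩ := e
  induction e using Sym2.ind with
  | _ x y =>
    rcases x with r | j <;> rcases y with r' | j'
    · simp at he
    · exact ⟨r, j', rfl⟩
    · exact ⟨r', j, Subtype.ext Sym2.eq_swap⟩
    · simp at he

theorem incidenceMatrix_eq_one_iff {V : Type} [DecidableEq V] {H : SimpleGraph V} {k : V}
    {e : H.edgeSet} : incidenceMatrix H k e = 1 ↔ k ∈ e.1 := by
  simp [incidenceMatrix]

theorem inl_mem_edgeK34_iff {r r' : Fin 3} {j : Fin 4} :
    (Sum.inl r' : Fin 3 ⊕ Fin 4) ∈ (edgeK34 r j).1 ↔ r' = r := by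
  simp [edgeK34]

theorem inr_mem_edgeK34_iff {r : Fin 3} {j j' : Fin 4} :
    (Sum.inr j' : Fin 3 ⊕ Fin 4) ∈ (edgeK34 r j).1 ↔ j' = j := by
  simp [edgeK34]

theorem edgeK34_injective {r r' : Fin 3} {j j' : Fin 4} (h : edgeK34 r j = edgeK34 r' j') :
    r = r' ∧ j = j' :=
  ⟨inl_mem_edgeK34_iff.1 (h ▸ inl_mem_edgeK34_iff.2 rfl),
    inr_mem_edgeK34_iff.1 (h ▸ inr_mem_edgeK34_iff.2 rfl)⟩

theorem incidenceMatrix_inl (r : Fin 3) (j : Fin 4) :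
    incidenceMatrix K34 (Sum.inl r) (edgeK34 r j) = 1 :=
  incidenceMatrix_eq_one_iff.2 (inl_mem_edgeK34_iff.2 rfl)

theorem incidenceMatrix_inr (r : Fin 3) (j : Fin 4) :
    incidenceMatrix K34 (Sum.inr j) (edgeK34 r j) = 1 :=
  incidenceMatrix_eq_one_iff.2 (inr_mem_edgeK34_iff.2 rfl)

theorem prod_incidence_inl {A : Type*} [CommMonoid A] (r : Fin 3) (g : K34.edgeSet → A) :
    ∏ i : {i // incidenceMatrix K34 (Sum.inl r) i = 1}, g i.1 = ∏ j, g (edgeK34 r j) := by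
  refine (Fintype.prod_bijective (fun j => (⟨edgeK34 r j, incidenceMatrix_inl r j⟩ :
    {i // incidenceMatrix K34 (Sum.inl r) i = 1})) ⟨fun j j' h => ?_, ?_⟩ _ _ fun _ => rfl).symm
  · exact (edgeK34_injective (Subtype.ext_iff.1 h)).2
  · rintro ⟨e, he⟩
    obtain ⟨r', j, rfl⟩ := exists_edgeK34 e
    obtain rfl := inl_mem_edgeK34_iff.1 (incidenceMatrix_eq_one_iff.1 he)
    exact ⟨j, rfl⟩

theorem prod_incidence_inr {A : Type*} [CommMonoid A] (j : Fin 4) (g : K34.edgeSet → A) :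
    ∏ i : {i // incidenceMatrix K34 (Sum.inr j) i = 1}, g i.1 = ∏ r, g (edgeK34 r j) := by
  refine (Fintype.prod_bijective (fun r => (⟨edgeK34 r j, incidenceMatrix_inr r j⟩ :
    {i // incidenceMatrix K34 (Sum.inr j) i = 1})) ⟨fun j j' h => ?_, ?_⟩ _ _ fun _ => rfl).symm
  · exact (edgeK34_injective (Subtype.ext_iff.1 h)).1
  · rintro ⟨e, he⟩
    obtain ⟨r', j, rfl⟩ := exists_edgeK34 e
    obtain rfl := inr_mem_edgeK34_iff.1 (incidenceMatrix_eq_one_iff.1 he)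
    exact ⟨r', rfl⟩

/-- Every vertex of `K_{3,4}` has degree at least `2`. -/
theorem exists_incidence_ne {k : Fin 3 ⊕ Fin 4} {i : K34.edgeSet}
    (h : incidenceMatrix K34 k i = 1) : ∃ i', i ≠ i' ∧ incidenceMatrix K34 k i' = 1 := by
  obtain ⟨r, j, rfl⟩ := exists_edgeK34 i
  rw [incidenceMatrix_eq_one_iff] at h
  rcases k with r' | j'
  · obtain rfl := inl_mem_edgeK34_iff.1 h
    exact ⟨edgeK34 r' (j + 1), fun hc => (by decide : ∀ j : Fin 4, j ≠ j + 1) _ (edgeK34_injective hc).2,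
      incidenceMatrix_inl _ _⟩
  · obtain rfl := inr_mem_edgeK34_iff.1 h
    exact ⟨edgeK34 (r + 1) j', fun hc => (by decide : ∀ r : Fin 3, r ≠ r + 1) _ (edgeK34_injective hc).1,
      incidenceMatrix_inr _ _⟩

/-- Two vertices of `K_{3,4}` have at most one common edge. -/
theorem incidence_unique {k l : Fin 3 ⊕ Fin 4} (hkl : k ≠ l) {i j : K34.edgeSet}
    (hik : incidenceMatrix K34 k i = 1) (hil : incidenceMatrix K34 l i = 1)
    (hjk : incidenceMatrix K34 k j = 1) (hjl : incidenceMatrix K34 l j = 1) : i = j := by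
  rw [incidenceMatrix_eq_one_iff] at *
  exact Subtype.ext (((Sym2.mem_and_mem_iff hkl).1 ⟨hik, hil⟩).trans
    ((Sym2.mem_and_mem_iff hkl).1 ⟨hjk, hjl⟩).symm)

end EdgesOfK34

/-! ### The colored graph of `K_{3,4}` -/

section StarGraph

/-- The vertices of the colored graph of the homogeneous system of `K_{3,4}`. -/
abbrev SignVertexK34 : Type := SolutionVertex (incidenceMatrix K34) 0

theorem starGraphK34_edgeColor_of_eq {v w : SignVertexK34} (h : v.1 = w.1) :
    starGraphK34.edgeColor s(v, w) = some (fun i => v.sign i * w.sign i) :=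
  if_pos h

theorem starGraphK34_edgeColor_of_ne {v w : SignVertexK34} (h : v.1 ≠ w.1) :
    starGraphK34.edgeColor s(v, w) = none :=
  if_neg h

theorem starGraphK34_exists_ends (e : starGraphK34.toEdgeColoredGraph.OtherEdge none) :
    ∃ v w : SignVertexK34, v ≠ w ∧ v.1 = w.1 ∧ e.1 = s(v, w) := by
  obtain ⟨e, he, hc⟩ := e
  induction e using Sym2.ind with
  | _ v w =>
    refine ⟨v, w, he.1, ?_, rfl⟩
    by_contra h
    exact hc (starGraphK34_edgeColor_of_ne h)

/-- The edge between two vertices for the same equation. -/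
def sameEdge {v w : SignVertexK34} (h : v ≠ w) (h1 : v.1 = w.1) :
    starGraphK34.toEdgeColoredGraph.OtherEdge none :=
  ⟨s(v, w), ⟨h, Or.inl h1⟩, by rw [starGraphK34_edgeColor_of_eq h1]; simp⟩

theorem incidence_of_sign_mul_sign {v w : SignVertexK34} {i : K34.edgeSet}
    (h : v.sign i * w.sign i = -1) :
    incidenceMatrix K34 v.1 i = 1 ∧ incidenceMatrix K34 w.1 i = 1 := by
  constructor
  · by_contra hc
    rw [v.sign_of_ne hc] at h
    simp at h
  · by_contra hc
    rw [w.sign_of_ne hc] at h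
    simp at h

/-- Adjacency of vertices for different equations, in the presence of a common variable. -/
theorem subdivided_adj_inl_iff {v w : SignVertexK34} (hvw : v.1 ≠ w.1) {i : K34.edgeSet}
    (hv : incidenceMatrix K34 v.1 i = 1) (hw : incidenceMatrix K34 w.1 i = 1) :
    (starGraphK34.toEdgeColoredGraph.subdivided none).Adj (Sum.inl v) (Sum.inl w) ↔
      v.sign i * w.sign i = -1 := by
  constructor
  · rintro ⟨⟨-, h | ⟨j, hj⟩⟩, -⟩
    · exact (hvw h).elim
    · obtain ⟨h1, h2⟩ := incidence_of_sign_mul_sign hj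
      rwa [incidence_unique hvw hv hw h1 h2]
  · intro h
    exact ⟨⟨fun hc => hvw (by rw [hc]), Or.inr ⟨i, h⟩⟩, starGraphK34_edgeColor_of_ne hvw⟩

theorem exists_sign_eq_neg (k : Fin 3 ⊕ Fin 4) {i : K34.edgeSet} (h : incidenceMatrix K34 k i = 1)
    {t : ℤ} (ht : t = 1 ∨ t = -1) : ∃ w : SignVertexK34, w.1 = k ∧ w.sign i = t := by
  rcases ht with rfl | rfl
  · exact ⟨.one _ k, rfl, SolutionVertex.sign_one h⟩
  · obtain ⟨i', h1, h2⟩ := exists_incidence_ne h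
    obtain ⟨w, hw, hs⟩ := (SolutionVertex.one (incidenceMatrix K34) k).exists_flip h h2 h1
    exact ⟨w, hw, by rw [hs, SolutionVertex.sign_one h]⟩

theorem exists_adj_K34 (k : Fin 3 ⊕ Fin 4) :
    ∃ c : Fin 3 → Fin 3 ⊕ Fin 4, Function.Injective c ∧ ∀ a, K34.Adj k (c a) := by
  rcases k with r | j
  · exact ⟨fun a => Sum.inr a.castSucc, fun a b h => by simpa using h, fun a => by simp⟩
  · exact ⟨Sum.inl, Sum.inl_injective, fun a => by simp⟩

theorem isSubdivisionGraph_starGraphK34 :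
    IsSubdivisionGraph (starGraphK34.toEdgeColoredGraph.subdivided none) where
  four_le_ncard v := by
    obtain ⟨c, hc, hadj⟩ := exists_adj_K34 v.1
    have hw : ∀ a, ∃ w : SignVertexK34, w.1 = c a ∧
        (starGraphK34.toEdgeColoredGraph.subdivided none).Adj (Sum.inl v) (Sum.inl w) := by
      intro a
      have h1 : incidenceMatrix K34 v.1 ⟨s(v.1, c a), hadj a⟩ = 1 :=
        incidenceMatrix_eq_one_iff.2 (by simp)
      have h2 : incidenceMatrix K34 (c a) ⟨s(v.1, c a), hadj a⟩ = 1 :=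
        incidenceMatrix_eq_one_iff.2 (by simp)
      obtain ⟨w, hw, hs⟩ := exists_sign_eq_neg (c a) h2
        (t := - v.sign ⟨s(v.1, c a), hadj a⟩) (by have := v.sign_eq_or h1; omega)
      refine ⟨w, hw, (subdivided_adj_inl_iff (by rw [hw]; exact (hadj a).ne) h1
        (by rw [hw]; exact h2)).2 ?_⟩
      rw [hs, mul_neg, v.sign_mul_self h1]
    choose x hx hadj' using hw
    obtain ⟨y, hy, hvy⟩ : ∃ y : SignVertexK34, v.1 = y.1 ∧ v ≠ y := by
      have h1 : incidenceMatrix K34 v.1 ⟨s(v.1, c 0), hadj 0⟩ = 1 :=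
        incidenceMatrix_eq_one_iff.2 (by simp)
      obtain ⟨w, hw, hs⟩ := exists_sign_eq_neg v.1 h1
        (t := - v.sign ⟨s(v.1, c 0), hadj 0⟩) (by have := v.sign_eq_or h1; omega)
      refine ⟨w, hw.symm, fun h => ?_⟩
      have := v.sign_eq_or h1
      rw [← h] at hs
      omega
    have hinj : Function.Injective (fun a : Option (Fin 3) =>
        a.elim (Sum.inr (sameEdge hvy hy)) (fun a => Sum.inl (x a)) :
        _ → SignVertexK34 ⊕ starGraphK34.toEdgeColoredGraph.OtherEdge none) := by
      rintro (_ | a) (_ | b) h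
      · rfl
      · simp at h
      · simp at h
      · have : x a = x b := by simpa using h
        rw [hc ((hx a).symm.trans ((congrArg Sigma.fst this).trans (hx b)))]
    have h4 := Set.ncard_le_ncard_of_injOn (s := Set.univ) _
      (t := {b | (starGraphK34.toEdgeColoredGraph.subdivided none).Adj (Sum.inl v) b})
      (fun a _ => ?_) hinj.injOn (Set.toFinite _)
    · simpa using h4
    · rcases a with _ | a
      · exact Sym2.mem_mk_left _ _
      · exact hadj' a
  ncard_eq_two e := by
    obtain ⟨v, w, hvw, -, he⟩ := starGraphK34_exists_ends e
    have : {b | (starGraphK34.toEdgeColoredGraph.subdivided none).Adj (Sum.inr e) b} =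
        {Sum.inl v, Sum.inl w} := by
      ext b
      rcases b with b | b
      · change b ∈ e.1 ↔ _
        simp [he]
      · change False ↔ _
        simp
    rw [this, Set.ncard_pair (by simpa using hvw)]
  isLeft_of_adj {e b} h := by
    rcases b with b | b
    · rfl
    · exact h.elim

end StarGraph

/-! ### Magic unitaries that preserve the coloring of the graph of `K_{3,4}` -/

section ColorPreserving

/-- The edges of the colored graph of `K_{3,4}` that are subdivided. -/
abbrev SameEdgeK34 : Type := starGraphK34.toEdgeColoredGraph.OtherEdge none

noncomputable instance : Fintype SignVertexK34 :=
  have : ∀ k, Finite {i // incidenceMatrix K34 k i = 1} := fun _ => inferInstance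
  Fintype.ofFinite _

noncomputable instance : Fintype SameEdgeK34 :=
  have : Finite (Sym2 SignVertexK34) := inferInstance
  Fintype.ofFinite _

/-- The graph obtained from the colored graph of `K_{3,4}` by subdividing the edges between
vertices for the same equation. -/
abbrev subdividedK34 : SimpleGraph (SignVertexK34 ⊕ SameEdgeK34) :=
  starGraphK34.toEdgeColoredGraph.subdivided none

/-- A magic unitary on the vertices of the subdivided graph of `K_{3,4}` that respects adjacency,
the vertex colors and the colors of the subdivided edges. -/
structure IsColorPreserving {A : Type*} [Ring A]
    (u : Matrix (SignVertexK34 ⊕ SameEdgeK34) (SignVertexK34 ⊕ SameEdgeK34) A) : Prop where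
  isMagicUnitary : IsMagicUnitary u
  respects_adj : Respects u subdividedK34.Adj
  inl_inr : ∀ v e, u (Sum.inl v) (Sum.inr e) = 0
  inr_inl : ∀ e v, u (Sum.inr e) (Sum.inl v) = 0
  vertexColor : ∀ v w, u (Sum.inl v) (Sum.inl w) ≠ 0 → v.1 = w.1
  edgeColor : ∀ e f, u (Sum.inr e) (Sum.inr f) ≠ 0 →
    starGraphK34.edgeColor e.1 = starGraphK34.edgeColor f.1

/-- An edge is determined by one of its ends and its color. -/
theorem sameEdge_unique {e f : SameEdgeK34} {v : SignVertexK34} (he : v ∈ e.1) (hf : v ∈ f.1)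
    (h : starGraphK34.edgeColor e.1 = starGraphK34.edgeColor f.1) : e = f := by
  obtain ⟨w, hw⟩ := he
  obtain ⟨x, hx⟩ := hf
  have key : ∀ (e : SameEdgeK34) (w : SignVertexK34), e.1 = s(v, w) → v.1 = w.1 := by
    intro e w he
    by_contra hc
    exact e.2.2 (by rw [he]; exact starGraphK34_edgeColor_of_ne hc)
  have hvw := key e w hw
  have hvx := key f x hx
  rw [hw, hx, starGraphK34_edgeColor_of_eq hvw, starGraphK34_edgeColor_of_eq hvx] at h
  refine Subtype.ext ?_
  rw [hw, hx]
  congr 1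
  have : w = x := by
    refine SolutionVertex.ext_sign (hvw.symm.trans hvx) fun i hi => ?_
    have h1 : v.sign i * w.sign i = v.sign i * x.sign i := congrFun (Option.some_injective _ h) i
    have h2 : incidenceMatrix K34 v.1 i = 1 := by rw [hvw]; exact hi
    have h3 := v.sign_mul_self h2
    exact mul_left_cancel₀ (left_ne_zero_of_mul_eq_one h3) h1
  rw [this]

namespace IsColorPreserving

variable {A : Type*} [Ring A]
  {u : Matrix (SignVertexK34 ⊕ SameEdgeK34) (SignVertexK34 ⊕ SameEdgeK34) A}

/-- The entry at two subdividing vertices `e` and `f = s(v', w')` of the same color is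
`u v v' + u v w'` for each end `v` of `e`: the projections `u v v'` and `u v w'` lie below
`u e f`, since `f` is the only edge of its color at `v'` and at `w'`. -/
theorem inr_inr_eq (hu : IsColorPreserving u) {e f : SameEdgeK34} {v v' w' : SignVertexK34}
    (hv : v ∈ e.1) (hf : f.1 = s(v', w')) (hne : v' ≠ w')
    (h : starGraphK34.edgeColor e.1 = starGraphK34.edgeColor f.1) :
    u (Sum.inr e) (Sum.inr f) = u (Sum.inl v) (Sum.inl v') + u (Sum.inl v) (Sum.inl w') := by
  have key : ∀ x, x ∈ f.1 →
      u (Sum.inr e) (Sum.inr f) * u (Sum.inl v) (Sum.inl x) = u (Sum.inl v) (Sum.inl x) := by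
    intro x hx
    conv_rhs => rw [← one_mul (u (Sum.inl v) (Sum.inl x)),
      ← hu.isMagicUnitary.row_sum (Sum.inr e), Finset.sum_mul]
    refine Eq.symm (Finset.sum_eq_single (Sum.inr f) (fun y _ hy => ?_) (by simp))
    by_contra h0
    have h1 := (hu.respects_adj h0).mp hv
    rcases y with y | g
    · rw [hu.inr_inl, zero_mul] at h0
      exact h0 rfl
    · have h2 := hu.edgeColor e g (left_ne_zero_of_mul h0)
      have h3 : x ∈ g.1 := h1
      exact hy (by rw [sameEdge_unique h3 hx (h2.symm.trans h)])
  have hsum : u (Sum.inr e) (Sum.inr f) =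
      ∑ y, u (Sum.inr e) (Sum.inr f) * u (Sum.inl v) y := by
    rw [← Finset.mul_sum, hu.isMagicUnitary.row_sum, mul_one]
  rw [hsum, Finset.sum_eq_add (Sum.inl v') (Sum.inl w') (by simpa using hne) ?_ (by simp) (by simp),
    key v' (by simp [hf]), key w' (by simp [hf])]
  rintro y - ⟨h1, h2⟩
  by_contra h0
  have h3 := (hu.respects_adj h0).mp hv
  rcases y with y | g
  · have h4 : y ∈ f.1 := h3
    rw [hf, Sym2.mem_iff] at h4
    simp only [ne_eq, Sum.inl.injEq] at h1 h2
    tauto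
  · exact h3

/-- The entry at `(v, v')` depends only on the color `v.sign * v'.sign`: it equals the one at
`(w, w')` if `s(v, w)` and `s(v', w')` have the same color. -/
theorem inl_inl_eq (hu : IsColorPreserving u) {v w v' w' : SignVertexK34} (hvw : v.1 = w.1)
    (hvw' : v'.1 = w'.1) (h : ∀ i, v.sign i * w.sign i = v'.sign i * w'.sign i) :
    u (Sum.inl v) (Sum.inl v') = u (Sum.inl w) (Sum.inl w') := by
  by_cases hc : v.1 = v'.1
  swap
  · rw [by_contra fun h0 => hc (hu.vertexColor _ _ h0),
      by_contra fun h0 => hc (hvw.trans ((hu.vertexColor _ _ h0).trans hvw'.symm))]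
  by_cases hne : v = w
  · subst hne
    have : v' = w' := by
      refine SolutionVertex.ext_sign hvw' fun i hi => ?_
      have h1 := h i
      rw [v.sign_mul_self (by rw [hc]; exact hi)] at h1
      exact mul_left_cancel₀ (left_ne_zero_of_mul_eq_one h1.symm)
        ((v'.sign_mul_self hi).trans h1)
    rw [this]
  have hne' : v' ≠ w' := by
    intro hh
    subst hh
    refine hne (SolutionVertex.ext_sign hvw fun i hi => ?_)
    have h1 := h i
    rw [v'.sign_mul_self (by rw [← hc]; exact hi)] at h1
    exact mul_left_cancel₀ (left_ne_zero_of_mul_eq_one h1)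
        ((v.sign_mul_self hi).trans h1.symm)
  -- `z` is a subdividing vertex of the color of `s(v, w)`
  let Z : SignVertexK34 ⊕ SameEdgeK34 → Prop := fun z => ∃ e : SameEdgeK34, z = Sum.inr e ∧
    starGraphK34.edgeColor e.1 = starGraphK34.edgeColor s(v, w)
  have hm := hu.isMagicUnitary
  have hZ : Respects u (fun x _ => Z x) := by
    refine Respects.of_eq_of_ne_zero fun x y h0 => propext ⟨?_, ?_⟩
    · rintro ⟨e, rfl, he⟩
      rcases y with y | f
      · exact (h0 (hu.inr_inl _ _)).elim
      · exact ⟨f, rfl, (hu.edgeColor _ _ h0).symm.trans he⟩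
    · rintro ⟨e, rfl, he⟩
      rcases x with y | f
      · exact (h0 (hu.inl_inr _ _)).elim
      · exact ⟨f, rfl, (hu.edgeColor _ _ h0).trans he⟩
  have hcol : starGraphK34.edgeColor s(v', w') = starGraphK34.edgeColor s(v, w) := by
    rw [starGraphK34_edgeColor_of_eq hvw, starGraphK34_edgeColor_of_eq hvw']
    simp only [h]
  have key : ∀ {a b : SignVertexK34} (t : SignVertexK34 ⊕ SameEdgeK34) (z), a ≠ b → a.1 = b.1 →
      starGraphK34.edgeColor s(a, b) = starGraphK34.edgeColor s(v, w) → Z z →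
      subdividedK34.Adj (Sum.inl a) z → subdividedK34.Adj z t → Sum.inl a ≠ t → t = Sum.inl b := by
    rintro a b t z hab hab' hs ⟨e, rfl, he⟩ h1 h2 h3
    rcases t with t | t
    · have h4 : a ∈ e.1 := h1
      have h5 : t ∈ e.1 := h2
      obtain rfl : e = sameEdge hab hab' :=
        sameEdge_unique h4 (Sym2.mem_mk_left a b) (he.trans hs.symm)
      rcases Sym2.mem_iff.1 h5 with rfl | rfl
      · exact (h3 rfl).elim
      · rfl
    · exact h2.elim
  refine hm.eq_of_respects (R := fun x y =>
      (∃ z, (subdividedK34.Adj x z ∧ Z z) ∧ subdividedK34.Adj z y) ∧ ¬ x = y)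
    ((hm.respects_exists (hu.respects_adj.map₂ (hZ.snd hm) And) hu.respects_adj).map₂
      hm.respects_eq (fun p q => p ∧ ¬ q))
    ⟨⟨Sum.inr (sameEdge hne hvw), ⟨Sym2.mem_mk_left v w, ⟨_, rfl, rfl⟩⟩, Sym2.mem_mk_right v w⟩,
      by simpa using hne⟩ ?_ ?_
  · rintro t ⟨⟨z, ⟨h1, h2⟩, h3⟩, h4⟩
    exact key t z hne' hvw' hcol h2 h1 h3 h4
  · rintro t ⟨⟨z, ⟨h1, h2⟩, h3⟩, h4⟩
    exact key t z hne'.symm hvw'.symm (by rw [Sym2.eq_swap, hcol]) h2 h3.symm h1.symm (Ne.symm h4)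

theorem sum_inl (hu : IsColorPreserving u) (v : SignVertexK34) :
    ∑ w, u (Sum.inl v) (Sum.inl w) = 1 := by
  have := hu.isMagicUnitary.row_sum (Sum.inl v)
  rw [Fintype.sum_sum_type] at this
  simpa [hu.inl_inr] using this

variable [Algebra ℂ A]

/-- The functional calculus of the row of the vertex `(k, 1)`, as an algebra homomorphism on the
functions on the vertices. It only sees their values at the vertices of color `k`. -/
noncomputable def rowHom (hu : IsColorPreserving u) (k : Fin 3 ⊕ Fin 4) :
    (SignVertexK34 → ℂ) →ₐ[ℂ] A :=
  AlgHom.ofLinearMap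
    { toFun := fun f => ∑ w, f w • u (Sum.inl (.one _ k)) (Sum.inl w)
      map_add' := fun f g => by simp [add_smul, Finset.sum_add_distrib]
      map_smul' := fun c f => by simp [mul_smul, Finset.smul_sum] }
    (by simpa using hu.sum_inl _)
    (fun f g => by
      classical
      simp only [LinearMap.coe_mk, AddHom.coe_mk, Finset.sum_mul, Finset.mul_sum,
        smul_mul_smul_comm]
      refine Finset.sum_congr rfl fun w _ => ?_
      rw [Finset.sum_eq_single w (fun x _ hx => ?_) (by simp)]
      · rw [hu.isMagicUnitary.idem, Pi.mul_apply]
      · rw [hu.isMagicUnitary.row_orth _ (by simpa using hx), smul_zero])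

theorem rowHom_apply (hu : IsColorPreserving u) (k : Fin 3 ⊕ Fin 4) (f : SignVertexK34 → ℂ) :
    hu.rowHom k f = ∑ w, f w • u (Sum.inl (.one _ k)) (Sum.inl w) :=
  rfl

theorem rowHom_congr (hu : IsColorPreserving u) {k : Fin 3 ⊕ Fin 4} {f g : SignVertexK34 → ℂ}
    (h : ∀ v, v.1 = k → f v = g v) : hu.rowHom k f = hu.rowHom k g := by
  rw [rowHom_apply, rowHom_apply]
  refine Finset.sum_congr rfl fun w _ => ?_
  by_cases h0 : u (Sum.inl (.one _ k)) (Sum.inl w) = 0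
  · rw [h0, smul_zero, smul_zero]
  · rw [h w (hu.vertexColor _ _ h0).symm]

/-- The self-adjoint unitary that belongs to the variable `i` in the equation `k`. -/
noncomputable def var (hu : IsColorPreserving u) (k : Fin 3 ⊕ Fin 4) (i : K34.edgeSet) : A :=
  hu.rowHom k (fun v => (v.sign i : ℂ))

theorem var_mul_self (hu : IsColorPreserving u) {k : Fin 3 ⊕ Fin 4} {i : K34.edgeSet}
    (h : incidenceMatrix K34 k i = 1) : hu.var k i * hu.var k i = 1 := by
  rw [var, ← map_mul, ← map_one (hu.rowHom k)]
  refine hu.rowHom_congr fun v hv => ?_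
  subst hv
  change ((v.sign i : ℤ) : ℂ) * ((v.sign i : ℤ) : ℂ) = 1
  exact_mod_cast v.sign_mul_self h

theorem var_commute (hu : IsColorPreserving u) (k : Fin 3 ⊕ Fin 4) (i j : K34.edgeSet) :
    Commute (hu.var k i) (hu.var k j) :=
  (Commute.all _ _).map (hu.rowHom k)

theorem one_eq_rowHom_prod (hu : IsColorPreserving u) (k : Fin 3 ⊕ Fin 4) :
    hu.rowHom k (fun v => ∏ i : {i // incidenceMatrix K34 k i = 1}, (v.sign i.1 : ℂ)) = 1 := by
  rw [← map_one (hu.rowHom k)]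
  refine hu.rowHom_congr fun v hv => ?_
  subst hv
  have h1 := congrArg (fun x : ℤˣ => ((x : ℤ) : ℂ)) v.2.2
  simp only [Pi.zero_apply, if_true, Units.val_one, Int.cast_one, Units.coe_prod,
    Int.cast_prod] at h1
  rw [Pi.one_apply, ← h1]
  refine Finset.prod_congr rfl fun i _ => ?_
  rw [v.sign_of_eq i.2]

theorem var_mul_inl (hu : IsColorPreserving u) (r : Fin 3) :
    hu.var (.inl r) (edgeK34 r 0) * hu.var (.inl r) (edgeK34 r 1) *
      hu.var (.inl r) (edgeK34 r 2) * hu.var (.inl r) (edgeK34 r 3) = 1 := by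
  rw [← hu.one_eq_rowHom_prod (.inl r)]
  simp only [var, ← map_mul]
  congr 1
  funext v
  rw [prod_incidence_inl r (fun i => (v.sign i : ℂ)), Fin.prod_univ_four]
  rfl

theorem var_mul_inr (hu : IsColorPreserving u) (j : Fin 4) :
    hu.var (.inr j) (edgeK34 0 j) * hu.var (.inr j) (edgeK34 1 j) *
      hu.var (.inr j) (edgeK34 2 j) = 1 := by
  rw [← hu.one_eq_rowHom_prod (.inr j)]
  simp only [var, ← map_mul]
  congr 1
  funext v
  rw [prod_incidence_inr j (fun i => (v.sign i : ℂ)), Fin.prod_univ_three]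
  rfl

/-- The two equations that contain the variable `i` give the same self-adjoint unitary. -/
theorem var_eq (hu : IsColorPreserving u) {k l : Fin 3 ⊕ Fin 4} (hkl : k ≠ l) {i : K34.edgeSet}
    (hk : incidenceMatrix K34 k i = 1) (hl : incidenceMatrix K34 l i = 1) :
    hu.var k i = hu.var l i := by
  have key : ∀ x y : SignVertexK34,
      ((x.sign i : ℤ) : ℂ) •
        (u (Sum.inl (.one _ k)) (Sum.inl x) * u (Sum.inl (.one _ l)) (Sum.inl y)) =
      ((y.sign i : ℤ) : ℂ) •
        (u (Sum.inl (.one _ k)) (Sum.inl x) * u (Sum.inl (.one _ l)) (Sum.inl y)) := by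
    intro x y
    by_cases h0 : u (Sum.inl (.one _ k)) (Sum.inl x) * u (Sum.inl (.one _ l)) (Sum.inl y) = 0
    · rw [h0, smul_zero, smul_zero]
    -- the vertices `(k, 1)` and `(l, 1)` are not adjacent, so neither are `x` and `y`
    have hx : k = x.1 := hu.vertexColor _ _ (left_ne_zero_of_mul h0)
    have hy : l = y.1 := hu.vertexColor _ _ (right_ne_zero_of_mul h0)
    have h1 := hu.respects_adj h0
    rw [hx] at hk
    rw [hy] at hl
    have h2 : ¬ subdividedK34.Adj (Sum.inl x) (Sum.inl y) := by
      rw [← h1, subdivided_adj_inl_iff (i := i) hkl (by rw [hx]; exact hk) (by rw [hy]; exact hl),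
        SolutionVertex.sign_one (by rw [hx]; exact hk),
        SolutionVertex.sign_one (by rw [hy]; exact hl)]
      decide
    rw [subdivided_adj_inl_iff (by rwa [← hx, ← hy]) hk hl] at h2
    have : x.sign i = y.sign i := by
      rcases x.sign_eq_or hk with h3 | h3 <;> rcases y.sign_eq_or hl with h4 | h4 <;>
        simp_all
    rw [this]
  calc hu.var k i = ∑ x : SignVertexK34, ∑ y : SignVertexK34, ((x.sign i : ℤ) : ℂ) •
        (u (Sum.inl (.one _ k)) (Sum.inl x) * u (Sum.inl (.one _ l)) (Sum.inl y)) := by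
        rw [var, rowHom_apply]
        refine Finset.sum_congr rfl fun x _ => ?_
        rw [← Finset.smul_sum, ← Finset.mul_sum, hu.sum_inl, mul_one]
    _ = ∑ y : SignVertexK34, ∑ x : SignVertexK34, ((y.sign i : ℤ) : ℂ) •
        (u (Sum.inl (.one _ k)) (Sum.inl x) * u (Sum.inl (.one _ l)) (Sum.inl y)) := by
        rw [Finset.sum_comm]
        simp only [key]
    _ = hu.var l i := by
        rw [var, rowHom_apply]
        refine Finset.sum_congr rfl fun y _ => ?_
        rw [← Finset.smul_sum, ← Finset.sum_mul]
        rw [hu.sum_inl, one_mul]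

/-- All entries are polynomials in the self-adjoint unitaries of the variables. -/
theorem inl_inl_mem (hu : IsColorPreserving u) {S : Subalgebra ℂ A}
    (hS : ∀ r j, hu.var (.inl r) (edgeK34 r j) ∈ S) (v w : SignVertexK34) :
    u (Sum.inl v) (Sum.inl w) ∈ S := by
  have hS' : ∀ k i, incidenceMatrix K34 k i = 1 → hu.var k i ∈ S := by
    intro k i hi
    obtain ⟨r, j, rfl⟩ := exists_edgeK34 i
    rcases k with r' | j'
    · obtain rfl := inl_mem_edgeK34_iff.1 (incidenceMatrix_eq_one_iff.1 hi)
      exact hS _ _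
    · rw [hu.var_eq (l := .inl r) (by simp) hi (incidenceMatrix_inl _ _)]
      exact hS _ _
  have hone : ∀ w : SignVertexK34, u (Sum.inl (.one _ w.1)) (Sum.inl w) ∈ S := by
    classical
    intro w
    have h1 : u (Sum.inl (.one _ w.1)) (Sum.inl w) = hu.rowHom w.1 (Pi.single w 1) := by
      rw [rowHom_apply, Finset.sum_eq_single w (fun x _ hx => by simp [hx]) (by simp)]
      simp
    -- the indicator function of `w` among the vertices of its color
    have h2 : hu.rowHom w.1 (Pi.single w 1) =
        hu.rowHom w.1 (∏ i : {i // incidenceMatrix K34 w.1 i = 1},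
          ((1 / 2 : ℂ) • (1 + (w.sign i.1 : ℂ) • fun v : SignVertexK34 => (v.sign i.1 : ℂ)))) := by
      refine hu.rowHom_congr fun v hv => ?_
      rw [Finset.prod_apply]
      by_cases hvw : v = w
      · subst hvw
        rw [Pi.single_eq_same, Finset.prod_eq_one]
        intro i _
        have h3 : (v.sign i.1 : ℂ) * (v.sign i.1 : ℂ) = 1 := by exact_mod_cast v.sign_mul_self i.2
        simp only [Pi.smul_apply, Pi.add_apply, Pi.one_apply, smul_eq_mul, h3]
        norm_num
      · rw [Pi.single_eq_of_ne hvw]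
        obtain ⟨i, hi, hne⟩ : ∃ i, incidenceMatrix K34 w.1 i = 1 ∧ v.sign i ≠ w.sign i := by
          by_contra! hc
          exact hvw (SolutionVertex.ext_sign hv fun i hi => hc i (by rw [← hv]; exact hi))
        refine (Finset.prod_eq_zero (Finset.mem_univ ⟨i, hi⟩) ?_).symm
        have h3 : (w.sign i : ℂ) * (v.sign i : ℂ) = -1 := by
          have h4 := w.sign_eq_or hi
          have h5 := v.sign_eq_or (by rw [hv]; exact hi)
          have : w.sign i * v.sign i = -1 := by
            rcases h4 with h4 | h4 <;> rcases h5 with h5 | h5 <;> simp_all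
          exact_mod_cast this
        simp [h3]
    rw [h1, h2]
    refine Subalgebra.prod_mem (S.comap (hu.rowHom w.1)) fun i _ => ?_
    refine Subalgebra.smul_mem _ (Subalgebra.add_mem _ (Subalgebra.one_mem _)
      (Subalgebra.smul_mem _ ?_ _)) _
    exact hS' w.1 i.1 i.2
  by_cases hvw : v.1 = w.1
  · obtain ⟨y, hy, hs⟩ := v.exists_sign_mul w (.one _ v.1) hvw.symm rfl
    rw [hu.inl_inl_eq (v := v) (v' := w) (w := .one _ v.1) (w' := y) rfl (hvw.symm.trans hy.symm)]
    · rw [← hy]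
      exact hone y
    · intro i
      rw [hs]
      by_cases hi : incidenceMatrix K34 v.1 i = 1
      · rw [SolutionVertex.sign_one hi, mul_one, mul_one, mul_left_comm,
          w.sign_mul_self (by rw [← hvw]; exact hi), mul_one]
      · rw [v.sign_of_ne hi, zero_mul, zero_mul, zero_mul, mul_zero]
  · rw [by_contra fun h0 => hvw (hu.vertexColor _ _ h0)]
    exact S.zero_mem

theorem mem (hu : IsColorPreserving u) {S : Subalgebra ℂ A}
    (hS : ∀ r j, hu.var (.inl r) (edgeK34 r j) ∈ S) (x y : SignVertexK34 ⊕ SameEdgeK34) :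
    u x y ∈ S := by
  rcases x with v | e <;> rcases y with w | f
  · exact hu.inl_inl_mem hS v w
  · rw [hu.inl_inr]
    exact S.zero_mem
  · rw [hu.inr_inl]
    exact S.zero_mem
  · by_cases h : starGraphK34.edgeColor e.1 = starGraphK34.edgeColor f.1
    · obtain ⟨v, w, -, -, he⟩ := starGraphK34_exists_ends e
      obtain ⟨v', w', hne, -, hf⟩ := starGraphK34_exists_ends f
      rw [hu.inr_inr_eq (v := v) (by simp [he]) hf hne h]
      exact S.add_mem (hu.inl_inl_mem hS _ _) (hu.inl_inl_mem hS _ _)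
    · rw [by_contra fun h0 => h (hu.edgeColor _ _ h0)]
      exact S.zero_mem

end IsColorPreserving

end ColorPreserving

/-! ### Finiteness of the algebra of the linear system of `K_{3,4}` -/

section Finiteness

/-- Adjoining an involution that normalizes a finite-dimensional subalgebra `S` gives the
finite-dimensional subalgebra `S + g S`. -/
theorem finiteDimensional_adjoin_insert {A : Type*} [Ring A] [Algebra ℂ A] {T : Set A} {g : A}
    (hT : FiniteDimensional ℂ (Algebra.adjoin ℂ T)) (hg : g * g = 1)
    (h : ∀ t ∈ T, g * t * g ∈ Algebra.adjoin ℂ T) :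
    FiniteDimensional ℂ (Algebra.adjoin ℂ (insert g T)) := by
  have hconj : ∀ s ∈ Algebra.adjoin ℂ T, g * s * g ∈ Algebra.adjoin ℂ T := by
    intro s hs
    induction hs using Algebra.adjoin_induction with
    | mem x hx => exact h x hx
    | algebraMap r =>
      rw [← Algebra.commutes, mul_assoc, hg, mul_one]
      exact Subalgebra.algebraMap_mem _ r
    | add x y _ _ hx hy =>
      rw [mul_add, add_mul]
      exact Subalgebra.add_mem _ hx hy
    | mul x y _ _ hx hy =>
      have : g * (x * y) * g = (g * x * g) * (g * y * g) := by
        simp only [mul_assoc]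
        rw [← mul_assoc g g, hg, one_mul]
      rw [this]
      exact Subalgebra.mul_mem _ hx hy
  let S := Algebra.adjoin ℂ T
  let N : Submodule ℂ A := Subalgebra.toSubmodule S ⊔
    (Subalgebra.toSubmodule S).map (LinearMap.mulLeft ℂ g)
  have hN : ∀ x, x ∈ N ↔ ∃ s ∈ S, ∃ t ∈ S, s + g * t = x := by
    intro x
    simp only [N, Submodule.mem_sup, Submodule.mem_map, Subalgebra.mem_toSubmodule,
      LinearMap.mulLeft_apply]
    constructor
    · rintro ⟨s, hs, _, ⟨t, ht, rfl⟩, rfl⟩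
      exact ⟨s, hs, t, ht, rfl⟩
    · rintro ⟨s, hs, t, ht, rfl⟩
      exact ⟨s, hs, _, ⟨t, ht, rfl⟩, rfl⟩
  have : FiniteDimensional ℂ (Subalgebra.toSubmodule S) := hT
  have hle : Subalgebra.toSubmodule (Algebra.adjoin ℂ (insert g T)) ≤ N := by
    intro x hx
    rw [Subalgebra.mem_toSubmodule] at hx
    induction hx using Algebra.adjoin_induction with
    | mem x hx =>
      rcases hx with rfl | hx
      · exact (hN x).2 ⟨0, S.zero_mem, 1, S.one_mem, by simp⟩
      · exact (hN x).2 ⟨x, Algebra.subset_adjoin hx, 0, S.zero_mem, by simp⟩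
    | algebraMap r => exact (hN _).2 ⟨_, S.algebraMap_mem r, 0, S.zero_mem, by simp⟩
    | add x y _ _ hx hy => exact N.add_mem hx hy
    | mul x y _ _ hx hy =>
      obtain ⟨s, hs, t, ht, rfl⟩ := (hN x).1 hx
      obtain ⟨s', hs', t', ht', rfl⟩ := (hN y).1 hy
      refine (hN _).2 ⟨s * s' + (g * t * g) * t',
        S.add_mem (S.mul_mem hs hs') (S.mul_mem (hconj t ht) ht'),
        (g * s * g) * t' + t * s', S.add_mem (S.mul_mem (hconj s hs) ht') (S.mul_mem ht hs'), ?_⟩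
      have : g * ((g * s * g) * t') = s * (g * t') := by
        simp only [← mul_assoc]
        rw [hg, one_mul]
      rw [mul_add, this]
      noncomm_ring
  exact Submodule.finiteDimensional_of_le hle

theorem finiteDimensional_adjoin_insert_of_commute {A : Type*} [Ring A] [Algebra ℂ A] {T : Set A}
    {g : A} (hT : FiniteDimensional ℂ (Algebra.adjoin ℂ T)) (hg : g * g = 1)
    (h : ∀ t ∈ T, Commute g t) : FiniteDimensional ℂ (Algebra.adjoin ℂ (insert g T)) := by
  refine finiteDimensional_adjoin_insert hT hg fun t ht => ?_
  rw [(h t ht).eq, mul_assoc, hg, mul_one]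
  exact Algebra.subset_adjoin ht

variable {A : Type*} [Ring A]

/-- The relations of the grid with the rows `a i`, `b i` and `a i * b i`, which are the variables of
the three equations of degree four. -/
structure IsMagicGrid (a b : Fin 4 → A) : Prop where
  a_mul_self : ∀ i, a i * a i = 1
  b_mul_self : ∀ i, b i * b i = 1
  commute_a : ∀ i j, Commute (a i) (a j)
  commute_b : ∀ i j, Commute (b i) (b j)
  commute_ab : ∀ i, Commute (a i) (b i)
  commute_mul : ∀ i j, Commute (a i * b i) (a j * b j)
  prod_a : a 0 * a 1 * a 2 = a 3
  prod_b : b 0 * b 1 * b 2 = b 3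
  prod_mul : (a 0 * b 0) * (a 1 * b 1) * (a 2 * b 2) = a 3 * b 3

namespace IsMagicGrid

variable {a b : Fin 4 → A}

theorem commute_mul_mul (h : IsMagicGrid a b) (i j : Fin 4) :
    Commute (a i * a j) (b i * b j) := by
  have h1 : b i * (a i * a j) * b j = b j * (a i * a j) * b i := by
    calc b i * (a i * a j) * b j = (b i * a i) * (a j * b j) := by simp only [mul_assoc]
      _ = (a j * b j) * (a i * b i) := by rw [← (h.commute_ab i).eq, (h.commute_mul i j).eq]
      _ = b j * (a j * a i) * b i := by rw [(h.commute_ab j).eq]; simp only [mul_assoc]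
      _ = b j * (a i * a j) * b i := by rw [(h.commute_a j i).eq]
  calc a i * a j * (b i * b j) = (b i * b i) * (a i * a j) * (b j * b i) := by
        rw [h.b_mul_self, one_mul, (h.commute_b i j).eq]
    _ = b i * (b i * (a i * a j) * b j) * b i := by simp only [mul_assoc]
    _ = b i * b j * (a i * a j) * (b i * b i) := by rw [h1]; simp only [mul_assoc]
    _ = b i * b j * (a i * a j) := by rw [h.b_mul_self, mul_one]

/-- The product of the equations makes `a j * a k` commute with `b i * b j`. -/
theorem commute_of_prod (h : IsMagicGrid a b) {i j k : Fin 4}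
    (hp : (a i * b i) * (a j * b j) * (a k * b k) = (a i * a j * a k) * (b i * b j * b k)) :
    Commute (a j * a k) (b i * b j) := by
  have h1 : a i * ((b i * (a j * b j) * a k) * b k) = a i * ((a j * a k * (b i * b j)) * b k) := by
    simpa only [mul_assoc] using hp
  have h2 := congrArg (fun x => a i * x * b k) h1
  have h3 := h.b_mul_self k
  have h4 := h.a_mul_self i
  have h5 := (h.commute_ab j).eq
  simp only [← mul_assoc] at h2
  simp only [h4, one_mul] at h2
  simp only [mul_assoc, h3, mul_one] at h2
  rw [commute_iff_eq]
  simp only [mul_assoc]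
  rw [← h2, ← mul_assoc (b j), ← h5, mul_assoc]

theorem commute_01_02 (h : IsMagicGrid a b) : Commute (a 0 * a 1) (b 0 * b 2) := by
  rw [(h.commute_b 0 2).eq]
  refine h.commute_of_prod ?_
  rw [mul_assoc, ((h.commute_mul 2 0).mul_right (h.commute_mul 2 1)).eq, h.prod_mul,
    mul_assoc (a 2), ((h.commute_a 2 0).mul_right (h.commute_a 2 1)).eq, h.prod_a, mul_assoc (b 2),
    ((h.commute_b 2 0).mul_right (h.commute_b 2 1)).eq, h.prod_b]

theorem commute_02_01 (h : IsMagicGrid a b) : Commute (a 0 * a 2) (b 0 * b 1) := by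
  rw [(h.commute_b 0 1).eq]
  refine h.commute_of_prod ?_
  rw [(h.commute_mul 1 0).eq, h.prod_mul, (h.commute_a 1 0).eq, h.prod_a,
    (h.commute_b 1 0).eq, h.prod_b]

/-- Conjugation by `b 0` is, on the products `a 0 * a j`, expressed by conjugation by `a 0`. -/
theorem conj_eq (h : IsMagicGrid a b) (j : Fin 4) :
    b 0 * (a 0 * a j) * b 0 = a 0 * (b 0 * b j) * a 0 * (b 0 * b j) * (a 0 * a j) := by
  have h1 : b 0 * b j * a j * (b 0 * b j) = b 0 * a j * b 0 := by
    calc b 0 * b j * a j * (b 0 * b j) = b 0 * (b j * a j) * (b j * b 0) := by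
          rw [(h.commute_b j 0).eq]; simp only [mul_assoc]
      _ = b 0 * a j * (b j * b j) * b 0 := by
          rw [← (h.commute_ab j).eq]; simp only [mul_assoc]
      _ = b 0 * a j * b 0 := by rw [h.b_mul_self, mul_one]
  symm
  calc a 0 * (b 0 * b j) * a 0 * (b 0 * b j) * (a 0 * a j)
      = a 0 * (b 0 * b j) * a 0 * ((b 0 * b j) * (a 0 * a j)) := by simp only [mul_assoc]
    _ = a 0 * (b 0 * b j) * (a 0 * a 0) * a j * (b 0 * b j) := by
        rw [← (h.commute_mul_mul 0 j).eq]; simp only [mul_assoc]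
    _ = a 0 * (b 0 * b j * a j * (b 0 * b j)) := by
        rw [h.a_mul_self, mul_one]; simp only [mul_assoc]
    _ = (a 0 * b 0) * a j * b 0 := by rw [h1]; simp only [mul_assoc]
    _ = b 0 * (a 0 * a j) * b 0 := by rw [(h.commute_ab 0).eq]; simp only [mul_assoc]

theorem mul_self_mul (h : IsMagicGrid a b) (i j : Fin 4) : (a i * a j) * (a i * a j) = 1 := by
  rw [mul_assoc, ← mul_assoc (a j), (h.commute_a j i).eq, mul_assoc, h.a_mul_self, mul_one,
    h.a_mul_self]

theorem mul_self_mul' (h : IsMagicGrid a b) (i j : Fin 4) : (b i * b j) * (b i * b j) = 1 := by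
  rw [mul_assoc, ← mul_assoc (b j), (h.commute_b j i).eq, mul_assoc, h.b_mul_self, mul_one,
    h.b_mul_self]

theorem conj_mul_self (h : IsMagicGrid a b) {w : A} (hw : w * w = 1) :
    (a 0 * w * a 0) * (a 0 * w * a 0) = 1 := by
  calc (a 0 * w * a 0) * (a 0 * w * a 0) = a 0 * w * (a 0 * a 0) * w * a 0 := by
        simp only [mul_assoc]
    _ = 1 := by
        rw [h.a_mul_self, mul_one, mul_assoc (a 0), hw, mul_one, h.a_mul_self]

/-- By `conj_eq`, the conjugate by `a 0` of `b 0 * b j` is a product of factors that commute with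
`b 0` or with `a 0 * a j`. -/
theorem conj_commute (h : IsMagicGrid a b) {j : Fin 4} {w : A} (hb : Commute (b 0) w)
    (ha : Commute (a 0 * a j) w) (hw : Commute (b 0 * b j) w) :
    Commute (a 0 * (b 0 * b j) * a 0) w := by
  have : a 0 * (b 0 * b j) * a 0 = b 0 * (a 0 * a j) * b 0 * (a 0 * a j) * (b 0 * b j) := by
    rw [h.conj_eq, mul_assoc _ (a 0 * a j) (a 0 * a j), h.mul_self_mul, mul_one,
      mul_assoc _ (b 0 * b j) (b 0 * b j), h.mul_self_mul', mul_one]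
  rw [this]
  exact ((((hb.mul_left ha).mul_left hb).mul_left ha).mul_left hw)

/-- The algebra generated by a magic grid is finite-dimensional. Besides `a 0` and `b 0` it is
generated by the products `b 0 * b j` and their conjugates by `a 0`, and by the products
`a 0 * a j`; these commute, `a 0` permutes them, and `b 0` normalizes the rest. -/
theorem exists_finiteDimensional [Algebra ℂ A] (h : IsMagicGrid a b) :
    ∃ S : Subalgebra ℂ A, FiniteDimensional ℂ S ∧ ∀ i, a i ∈ S ∧ b i ∈ S := by
  set p := a 0 * a 1 with hp
  set q := a 0 * a 2 with hq
  set w := b 0 * b 1 with hw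
  set x := b 0 * b 2 with hx
  set w' := a 0 * w * a 0 with hw'
  set x' := a 0 * x * a 0 with hx'
  have hpp : p * p = 1 := h.mul_self_mul 0 1
  have hqq : q * q = 1 := h.mul_self_mul 0 2
  have hww : w * w = 1 := h.mul_self_mul' 0 1
  have hxx : x * x = 1 := h.mul_self_mul' 0 2
  have hww' : w' * w' = 1 := h.conj_mul_self hww
  have hxx' : x' * x' = 1 := h.conj_mul_self hxx
  have hb0w : Commute (b 0) w := (h.commute_b 0 0).mul_right (h.commute_b 0 1)
  have hb0x : Commute (b 0) x := (h.commute_b 0 0).mul_right (h.commute_b 0 2)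
  have ha0p : Commute (a 0) p := (h.commute_a 0 0).mul_right (h.commute_a 0 1)
  have ha0q : Commute (a 0) q := (h.commute_a 0 0).mul_right (h.commute_a 0 2)
  have hpw : Commute p w := h.commute_mul_mul 0 1
  have hqx : Commute q x := h.commute_mul_mul 0 2
  have hpx : Commute p x := h.commute_01_02
  have hqw : Commute q w := h.commute_02_01
  have hwx : Commute w x :=
    hb0x.mul_left ((h.commute_b 1 0).mul_right (h.commute_b 1 2))
  have hpq : Commute p q := ha0q.mul_left ((h.commute_a 1 0).mul_right (h.commute_a 1 2))
  have hw'w : Commute w' w := h.conj_commute hb0w hpw (Commute.refl _)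
  have hw'x : Commute w' x := h.conj_commute hb0x hpx hwx
  have hx'w : Commute x' w := h.conj_commute hb0w hqw hwx.symm
  have hx'x : Commute x' x := h.conj_commute hb0x hqx (Commute.refl _)
  have haw' : a 0 * w' * a 0 = w := by
    rw [hw', ← mul_assoc, ← mul_assoc, h.a_mul_self, one_mul, mul_assoc, h.a_mul_self, mul_one]
  have hax' : a 0 * x' * a 0 = x := by
    rw [hx', ← mul_assoc, ← mul_assoc, h.a_mul_self, one_mul, mul_assoc, h.a_mul_self, mul_one]
  have hx'w' : Commute x' w' := by
    have e1 : x' * w' = a 0 * (x * w) * a 0 := by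
      rw [hx', hw', mul_assoc _ (a 0), ← mul_assoc (a 0) (a 0 * w), ← mul_assoc (a 0) (a 0) w,
        h.a_mul_self, one_mul]
      simp only [mul_assoc]
    have e2 : w' * x' = a 0 * (w * x) * a 0 := by
      rw [hx', hw', mul_assoc _ (a 0), ← mul_assoc (a 0) (a 0 * x), ← mul_assoc (a 0) (a 0) x,
        h.a_mul_self, one_mul]
      simp only [mul_assoc]
    rw [commute_iff_eq, e1, e2, hwx.eq]
  have hpw' : Commute p w' := (ha0p.symm.mul_right hpw).mul_right ha0p.symm
  have hpx' : Commute p x' := (ha0p.symm.mul_right hpx).mul_right ha0p.symm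
  have hqw' : Commute q w' := (ha0q.symm.mul_right hqw).mul_right ha0q.symm
  have hqx' : Commute q x' := (ha0q.symm.mul_right hqx).mul_right ha0q.symm
  have hbw' : Commute (b 0) w' :=
    ((h.commute_ab 0).symm.mul_right hb0w).mul_right (h.commute_ab 0).symm
  have hbx' : Commute (b 0) x' :=
    ((h.commute_ab 0).symm.mul_right hb0x).mul_right (h.commute_ab 0).symm
  have f0 : FiniteDimensional ℂ (Algebra.adjoin ℂ (∅ : Set A)) := by
    rw [Algebra.adjoin_empty]
    exact inferInstanceAs (FiniteDimensional ℂ (⊥ : Subalgebra ℂ A))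
  have f1 := finiteDimensional_adjoin_insert_of_commute f0 hww (by simp)
  have f2 := finiteDimensional_adjoin_insert_of_commute f1 hxx (by simpa using hwx.symm)
  have f3 := finiteDimensional_adjoin_insert_of_commute f2 hww'
    (by simpa using ⟨hw'x, hw'w⟩)
  have f4 := finiteDimensional_adjoin_insert_of_commute f3 hxx'
    (by simpa using ⟨hx'w', hx'x, hx'w⟩)
  have f5 := finiteDimensional_adjoin_insert_of_commute f4 hpp
    (by simpa using ⟨hpx', hpw', hpx, hpw⟩)
  have f6 := finiteDimensional_adjoin_insert_of_commute f5 hqq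
    (by simpa using ⟨hpq.symm, hqx', hqw', hqx, hqw⟩)
  have f7 := finiteDimensional_adjoin_insert f6 (h.a_mul_self 0) (by
    have hc : ∀ {t}, Commute (a 0) t → a 0 * t * a 0 = t := fun ht => by
      rw [ht.eq, mul_assoc, h.a_mul_self, mul_one]
    simp only [Set.mem_insert_iff, Set.mem_empty_iff_false, or_false]
    rintro t (rfl | rfl | rfl | rfl | rfl | rfl)
    · rw [hc ha0q]; exact Algebra.subset_adjoin (by simp)
    · rw [hc ha0p]; exact Algebra.subset_adjoin (by simp)
    · rw [hax']; exact Algebra.subset_adjoin (by simp)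
    · rw [haw']; exact Algebra.subset_adjoin (by simp)
    · exact Algebra.subset_adjoin (by simp [hx'])
    · exact Algebra.subset_adjoin (by simp [hw']))
  have f8 := finiteDimensional_adjoin_insert f7 (h.b_mul_self 0) (by
    have hc : ∀ {t}, Commute (b 0) t → b 0 * t * b 0 = t := fun ht => by
      rw [ht.eq, mul_assoc, h.b_mul_self, mul_one]
    simp only [Set.mem_insert_iff, Set.mem_empty_iff_false, or_false]
    rintro t (rfl | rfl | rfl | rfl | rfl | rfl | rfl)
    · rw [hc (h.commute_ab 0).symm]; exact Algebra.subset_adjoin (by simp)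
    · rw [hq, h.conj_eq 2]
      exact mul_mem (mul_mem (Algebra.subset_adjoin (by simp [hx', hx]))
        (Algebra.subset_adjoin (by simp [hx]))) (Algebra.subset_adjoin (by simp))
    · rw [hp, h.conj_eq 1]
      exact mul_mem (mul_mem (Algebra.subset_adjoin (by simp [hw', hw]))
        (Algebra.subset_adjoin (by simp [hw]))) (Algebra.subset_adjoin (by simp))
    · rw [hc hbx']; exact Algebra.subset_adjoin (by simp)
    · rw [hc hbw']; exact Algebra.subset_adjoin (by simp)
    · rw [hc hb0x]; exact Algebra.subset_adjoin (by simp)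
    · rw [hc hb0w]; exact Algebra.subset_adjoin (by simp))
  refine ⟨_, f8, ?_⟩
  set S := Algebra.adjoin ℂ (insert (b 0) (insert (a 0) (insert q (insert p
    (insert x' (insert w' (insert x (insert w (∅ : Set A)))))))))
  have hb0 : b 0 ∈ S := Algebra.subset_adjoin (by simp)
  have ha0 : a 0 ∈ S := Algebra.subset_adjoin (by simp)
  have ha1 : a 1 ∈ S := by
    have : a 1 = a 0 * p := by rw [hp, ← mul_assoc, h.a_mul_self, one_mul]
    rw [this]
    exact mul_mem ha0 (Algebra.subset_adjoin (by simp))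
  have ha2 : a 2 ∈ S := by
    have : a 2 = a 0 * q := by rw [hq, ← mul_assoc, h.a_mul_self, one_mul]
    rw [this]
    exact mul_mem ha0 (Algebra.subset_adjoin (by simp))
  have hb1 : b 1 ∈ S := by
    have : b 1 = b 0 * w := by rw [hw, ← mul_assoc, h.b_mul_self, one_mul]
    rw [this]
    exact mul_mem hb0 (Algebra.subset_adjoin (by simp))
  have hb2 : b 2 ∈ S := by
    have : b 2 = b 0 * x := by rw [hx, ← mul_assoc, h.b_mul_self, one_mul]
    rw [this]
    exact mul_mem hb0 (Algebra.subset_adjoin (by simp))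
  intro i
  fin_cases i
  · exact ⟨ha0, hb0⟩
  · exact ⟨ha1, hb1⟩
  · exact ⟨ha2, hb2⟩
  · refine ⟨?_, ?_⟩
    · change a 3 ∈ S
      rw [← h.prod_a]
      exact mul_mem (mul_mem ha0 ha1) ha2
    · change b 3 ∈ S
      rw [← h.prod_b]
      exact mul_mem (mul_mem hb0 hb1) hb2

end IsMagicGrid

end Finiteness

/-! ### Finiteness of the quantum automorphism group -/

section FiniteQut

namespace IsColorPreserving

variable {A : Type*} [Ring A] [Algebra ℂ A]
  {u : Matrix (SignVertexK34 ⊕ SameEdgeK34) (SignVertexK34 ⊕ SameEdgeK34) A}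

theorem var_inr (hu : IsColorPreserving u) (r : Fin 3) (j : Fin 4) :
    hu.var (.inr j) (edgeK34 r j) = hu.var (.inl r) (edgeK34 r j) :=
  hu.var_eq (by simp) (incidenceMatrix_inr r j) (incidenceMatrix_inl r j)

/-- In each of the equations of degree three, the third variable is the product of the others. -/
theorem var_two (hu : IsColorPreserving u) (j : Fin 4) :
    hu.var (.inl 2) (edgeK34 2 j) =
      hu.var (.inl 0) (edgeK34 0 j) * hu.var (.inl 1) (edgeK34 1 j) := by
  have h1 := hu.var_mul_inr j
  simp only [hu.var_inr] at h1
  have h2 := congrArg (· * hu.var (.inl 2) (edgeK34 2 j)) h1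
  simp only [mul_assoc, hu.var_mul_self (incidenceMatrix_inl 2 j), mul_one, one_mul] at h2
  exact h2.symm

theorem prod_var (hu : IsColorPreserving u) (r : Fin 3) :
    hu.var (.inl r) (edgeK34 r 0) * hu.var (.inl r) (edgeK34 r 1) *
      hu.var (.inl r) (edgeK34 r 2) = hu.var (.inl r) (edgeK34 r 3) := by
  have h2 := congrArg (· * hu.var (.inl r) (edgeK34 r 3)) (hu.var_mul_inl r)
  simpa only [mul_assoc, hu.var_mul_self (incidenceMatrix_inl r 3), mul_one, one_mul] using h2

theorem isMagicGrid (hu : IsColorPreserving u) :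
    IsMagicGrid (fun j => hu.var (.inl 0) (edgeK34 0 j))
      (fun j => hu.var (.inl 1) (edgeK34 1 j)) where
  a_mul_self j := hu.var_mul_self (incidenceMatrix_inl 0 j)
  b_mul_self j := hu.var_mul_self (incidenceMatrix_inl 1 j)
  commute_a _ _ := hu.var_commute _ _ _
  commute_b _ _ := hu.var_commute _ _ _
  commute_ab j := by
    simp only [← hu.var_inr]
    exact hu.var_commute _ _ _
  commute_mul i j := by
    simp only [← hu.var_two]
    exact hu.var_commute _ _ _
  prod_a := hu.prod_var 0
  prod_b := hu.prod_var 1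
  prod_mul := by
    simp only [← hu.var_two]
    exact hu.prod_var 2

theorem exists_finiteDimensional (hu : IsColorPreserving u) :
    ∃ S : Subalgebra ℂ A, FiniteDimensional ℂ S ∧ ∀ x y, u x y ∈ S := by
  obtain ⟨S, hS, h⟩ := hu.isMagicGrid.exists_finiteDimensional
  refine ⟨S, hS, hu.mem fun r j => ?_⟩
  fin_cases r
  · exact (h j).1
  · exact (h j).2
  · exact (hu.var_two j) ▸ mul_mem (h j).1 (h j).2

end IsColorPreserving

/-- `C(Qut(G))` is finite-dimensional as soon as its generators lie in a finite-dimensional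
subalgebra, because such a subalgebra is closed. -/
theorem hasFiniteQut_of_mem {V : Type} [Fintype V] {G : SimpleGraph V}
    {S : Subalgebra ℂ (qutAlgebra.{w} G)} (hS : FiniteDimensional ℂ S)
    (h : ∀ x y, qutMatrix.{w} G x y ∈ S) : HasFiniteQut.{w} G := by
  let T : Subalgebra ℂ (QutProduct.{w} G) := S.map (qutAlgebra G).toSubalgebra.val
  have hT : FiniteDimensional ℂ (Subalgebra.toSubmodule T) := by
    have : FiniteDimensional ℂ (Subalgebra.toSubmodule S) := hS
    exact inferInstanceAs (FiniteDimensional ℂ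
      ((Subalgebra.toSubmodule S).map (qutAlgebra G).toSubalgebra.val.toLinearMap))
  have hgen : ∀ x y, qutGenerator.{w} G x y ∈ T := fun x y =>
    ⟨qutMatrix G x y, h x y, rfl⟩
  have hstar : ∀ x y, star (qutGenerator.{w} G x y) = qutGenerator G x y := fun x y =>
    congrArg Subtype.val ((qutMatrix_isQuantumAutomorphism G).isStarProjection x y).isSelfAdjoint
  have hle : ((StarAlgebra.adjoin ℂ
      (Set.range fun p : V × V => qutGenerator.{w} G p.1 p.2) : StarSubalgebra ℂ _) :
        Set (QutProduct.{w} G)) ⊆ T := by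
    intro x hx
    refine Algebra.adjoin_le (S := T) ?_ hx
    rintro y (⟨p, rfl⟩ | ⟨p, hp⟩)
    · exact hgen _ _
    · have : y = qutGenerator G p.1 p.2 := by rw [← star_star y, ← hp, hstar]
      exact this ▸ hgen _ _
  have hclosed : IsClosed (T : Set (QutProduct.{w} G)) :=
    Submodule.closed_of_finiteDimensional (Subalgebra.toSubmodule T)
  have hle' : Subalgebra.toSubmodule (qutAlgebra.{w} G).toSubalgebra ≤ Subalgebra.toSubmodule T :=
    fun x hx => closure_minimal hle hclosed hx
  exact Submodule.finiteDimensional_of_le hle'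

variable (n : Fin 3 ⊕ Fin 4 → ℕ) (m : Option (K34.edgeSet → ℤ) → ℕ)

theorem isColorPreserving_root (hn : Function.Injective n)
    (hm : Set.InjOn m {c | c ≠ none ∧
      ∃ e ∈ starGraphK34.graph.edgeSet, starGraphK34.edgeColor e = c})
    {A : Type*} [CStarAlgebra A] {u : Matrix (StarVertexK34 n m) (StarVertexK34 n m) A}
    (hu : IsQuantumAutomorphism (starGraphK34'' n m) u) :
    IsColorPreserving (fun b c => u ((starGraphK34.pathAttachment none n m).root b)
      ((starGraphK34.pathAttachment none n m).root c)) := by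
  set P := starGraphK34.pathAttachment none n m with hP
  have hK := isSubdivisionGraph_starGraphK34
  have hM := hu.isMagicUnitary
  have hG := hu.respects_adj
  have hleft : ∀ b c, u (P.root b) (P.root c) ≠ 0 → ((b.isLeft : Prop) = c.isLeft) := by
    intro b c h
    simpa using (P.respects_isLeft hK hM hG).eq_of_ne_zero hM h
  have hlen : ∀ b c, u (P.root b) (P.root c) ≠ 0 →
      starGraphK34.pathLength none n m b = starGraphK34.pathLength none n m c := by
    intro b c h
    simpa using (P.respects_len hK hM hG).eq_of_ne_zero hM h
  exact
  { isMagicUnitary := P.isMagicUnitary_root hK hM hG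
    respects_adj := by
      intro b c b' c' h
      have := hG h
      rwa [P.adj_root, P.adj_root] at this
    inl_inr := fun v e => by
      by_contra h
      simpa using hleft _ _ h
    inr_inl := fun v e => by
      by_contra h
      simpa using hleft _ _ h
    vertexColor := fun v w h => hn (hlen _ _ h)
    edgeColor := fun e f h => hm ⟨e.2.2, e.1, e.2.1, rfl⟩ ⟨f.2.2, f.1, f.2.1, rfl⟩ (hlen _ _ h) }

theorem hasFiniteQut_starGraphK34 (hn : Function.Injective n)
    (hm : Set.InjOn m {c | c ≠ none ∧
      ∃ e ∈ starGraphK34.graph.edgeSet, starGraphK34.edgeColor e = c}) :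
    HasFiniteQut.{w} (starGraphK34'' n m) := by
  have hu := qutMatrix_isQuantumAutomorphism.{w} (starGraphK34'' n m)
  obtain ⟨S, hS, h⟩ := (isColorPreserving_root n m hn hm hu).exists_finiteDimensional
  have hK := isSubdivisionGraph_starGraphK34
  refine hasFiniteQut_of_mem hS fun x y => ?_
  by_cases hl : (starGraphK34.pathAttachment none n m).level x =
      (starGraphK34.pathAttachment none n m).level y
  · rw [PathAttachment.apply_eq_apply_root _ hK hu.isMagicUnitary hu.respects_adj hl]
    exact h _ _
  · rw [PathAttachment.apply_eq_zero_of_level_ne _ hK hu.isMagicUnitary hu.respects_adj hl]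
    exact S.zero_mem

end FiniteQut

/-! ### Quantum automorphisms from automorphisms of the parts of a graph -/

section BlockAutomorphisms

variable {W K Γ : Type} [Fintype W] [Fintype Γ] {A : Type*} [CStarAlgebra A]

open Classical in
/-- The matrix that acts on each part `κ ⁻¹' {k}` of a graph by the random permutation `act c`,
where `c` is distributed according to the projection-valued measure `q k`. -/
noncomputable def blockUnitary (κ : W → K) (act : Γ → W → W) (q : K → Γ → A) : Matrix W W A :=
  fun x y => ∑ c, if act c x = y then q (κ x) c else 0

open Classical in
/-- The hypothesis `hadj` compares the parts pairwise: for vertices `x` and `y` of the same part it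
holds if `act` preserves adjacency there. -/
theorem isQuantumAutomorphism_blockUnitary {G : SimpleGraph W} {κ : W → K} {act : Γ → W → W}
    {q : K → Γ → A} (hact : ∀ c x, act c (act c x) = x) (hκ : ∀ c x, κ (act c x) = κ x)
    (hq : ∀ k c, IsStarProjection (q k c)) (hsum : ∀ k, ∑ c, q k c = 1)
    (hadj : ∀ x y, ∑ c, (if G.Adj (act c x) y then q (κ x) c else 0) =
      ∑ c, (if G.Adj x (act c y) then q (κ y) c else 0)) :
    IsQuantumAutomorphism G (blockUnitary κ act q) where
  isStarProjection x y :=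
    { isIdempotentElem := by
        simp only [IsIdempotentElem, blockUnitary, Finset.sum_mul, Finset.mul_sum]
        refine Finset.sum_congr rfl fun c _ => ?_
        rw [Finset.sum_eq_single c (fun d _ hd => ?_) (by simp)]
        · split_ifs
          · exact (hq _ _).isIdempotentElem
          · simp
        · split_ifs
          · exact IsStarProjection.mul_eq_zero_of_sum_eq_one (hq _) (hsum _) hd
          all_goals simp
      isSelfAdjoint := by
        refine isSelfAdjoint_sum _ fun c _ => ?_
        split_ifs
        · exact (hq _ _).isSelfAdjoint
        · exact IsSelfAdjoint.zero _ }
  row_sum x := by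
    simp only [blockUnitary]
    rw [Finset.sum_comm]
    simp [hsum]
  col_sum y := by
    simp only [blockUnitary]
    rw [Finset.sum_comm, ← hsum (κ y)]
    refine Finset.sum_congr rfl fun c _ => ?_
    rw [Finset.sum_eq_single (act c y)]
    · rw [hact, if_pos rfl, hκ]
    · intro x _ hx
      rw [if_neg]
      rintro rfl
      exact hx (hact c x).symm
    · simp
  adjMatrix_comm := by
    ext x y
    rw [SimpleGraph.adjMatrix_mul_apply, SimpleGraph.mul_adjMatrix_apply]
    simp only [blockUnitary]
    rw [Finset.sum_comm, Finset.sum_comm (s := G.neighborFinset y)]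
    refine Eq.trans ?_ ((hadj x y).symm.trans ?_)
    · refine Finset.sum_congr rfl fun c _ => ?_
      have : ∀ z, (if act c z = y then q (κ z) c else 0) =
          if z = act c y then q (κ y) c else 0 := by
        intro z
        by_cases hz : act c z = y
        · rw [if_pos hz, if_pos (by rw [← hz, hact]), ← hz, hκ]
        · rw [if_neg hz, if_neg]
          rintro rfl
          exact hz (hact c y)
      simp only [this, Finset.sum_ite_eq', SimpleGraph.mem_neighborFinset]
    · refine Finset.sum_congr rfl fun c _ => ?_
      simp only [Finset.sum_ite_eq, SimpleGraph.mem_neighborFinset]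
      simp only [G.adj_comm]

end BlockAutomorphisms

/-! ### Joint spectral measures of two commuting involutions -/

section JointSpectralMeasure

variable {A : Type*} [CStarAlgebra A]

/-- The joint spectral projection of two commuting self-adjoint unitaries at a pair of signs. -/
noncomputable def jointProjection (s t : A) (c : ℤˣ × ℤˣ) : A :=
  (1 / 4 : ℂ) • ((1 + (c.1 : ℤ) • s) * (1 + (c.2 : ℤ) • t))

theorem isStarProjection_jointProjection {s t : A} (hs : IsSelfAdjoint s) (ht : IsSelfAdjoint t)
    (hss : s * s = 1) (htt : t * t = 1) (hst : Commute s t) (c : ℤˣ × ℤˣ) :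
    IsStarProjection (jointProjection s t c) := by
  have key : ∀ (x : A) (e : ℤˣ), x * x = 1 →
      (1 + (e : ℤ) • x) * (1 + (e : ℤ) • x) = (2 : ℂ) • (1 + (e : ℤ) • x) := by
    intro x e hx
    rw [two_smul]
    rcases Int.units_eq_one_or e with rfl | rfl <;> simp [mul_add, add_mul, hx]
    abel
  have hc : Commute (1 + (c.1 : ℤ) • s) (1 + (c.2 : ℤ) • t) :=
    (Commute.one_left _).add_left
      (((Commute.one_right s).add_right (hst.smul_right _)).smul_left _)
  constructor
  · rw [IsIdempotentElem, jointProjection, smul_mul_smul_comm, hc.symm.mul_mul_mul_comm,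
      key s _ hss, key t _ htt, smul_mul_smul_comm, smul_smul]
    norm_num
  · refine IsSelfAdjoint.smul (by simp [IsSelfAdjoint]) ?_
    rw [IsSelfAdjoint, star_mul, star_add, star_add, star_one, star_zsmul, star_zsmul, hs.star_eq,
      ht.star_eq, hc.eq]

theorem jointProjection_eq (s t : A) (c : ℤˣ × ℤˣ) :
    jointProjection s t c = (1 / 4 : ℂ) • (1 + (c.1 : ℤ) • s + (c.2 : ℤ) • t +
      ((c.1 * c.2 : ℤˣ) : ℤ) • (s * t)) := by
  rw [jointProjection]
  congr 1
  simp only [mul_add, add_mul, one_mul, mul_one, smul_mul_smul_comm, Units.val_mul]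
  abel

theorem sum_jointProjection (s t : A) : ∑ c, jointProjection s t c = 1 := by
  simp only [jointProjection_eq, Fintype.sum_prod_type, UnitsInt.univ]
  simp
  module

theorem sum_jointProjection_fst (s t : A) (e : ℤˣ) :
    ∑ c, (if c.1 = e then jointProjection s t c else 0) = (1 / 2 : ℂ) • (1 + (e : ℤ) • s) := by
  simp only [jointProjection_eq, Fintype.sum_prod_type, UnitsInt.univ]
  rcases Int.units_eq_one_or e with rfl | rfl <;> simp <;> module

theorem sum_jointProjection_snd (s t : A) (e : ℤˣ) :
    ∑ c, (if c.2 = e then jointProjection s t c else 0) = (1 / 2 : ℂ) • (1 + (e : ℤ) • t) := by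
  simp only [jointProjection_eq, Fintype.sum_prod_type, UnitsInt.univ]
  rcases Int.units_eq_one_or e with rfl | rfl <;> simp <;> module

theorem sum_jointProjection_mul (s t : A) (e : ℤˣ) :
    ∑ c, (if c.1 * c.2 = e then jointProjection s t c else 0) =
      (1 / 2 : ℂ) • (1 + (e : ℤ) • (s * t)) := by
  simp only [jointProjection_eq, Fintype.sum_prod_type, UnitsInt.univ]
  rcases Int.units_eq_one_or e with rfl | rfl <;> simp <;> module

end JointSpectralMeasure

/-! ### A noncommutative solution of the linear system of `K_{3,4}` -/

section Pauli

open scoped ComplexOrder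

/-- Self-adjoint unitaries in a `3 × 2` pattern; repeated twice they solve the homogeneous linear
system of `K_{3,4}`: the rows are `(y r 0, y r 1, y r 0, y r 1)`, and the third entry of a column is
the product of the others. -/
structure IsPauliGrid {A : Type*} [CStarAlgebra A] (y : Fin 3 → Fin 2 → A) : Prop where
  isSelfAdjoint : ∀ r p, IsSelfAdjoint (y r p)
  mul_self : ∀ r p, y r p * y r p = 1
  commute_row : ∀ r, Commute (y r 0) (y r 1)
  commute_col : ∀ p, Commute (y 0 p) (y 1 p)
  mul_col : ∀ p, y 2 p = y 0 p * y 1 p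

/-- The integer matrices of the Pauli operators `X ⊗ 1`, `1 ⊗ X`, `1 ⊗ Z`, `Z ⊗ 1`, and of the
products `X ⊗ Z`, `Z ⊗ X`. -/
def pauliInt : Fin 3 → Fin 2 → Matrix (Fin 4) (Fin 4) ℤ :=
  ![![!![0, 0, 1, 0; 0, 0, 0, 1; 1, 0, 0, 0; 0, 1, 0, 0],
      !![0, 1, 0, 0; 1, 0, 0, 0; 0, 0, 0, 1; 0, 0, 1, 0]],
    ![!![1, 0, 0, 0; 0, -1, 0, 0; 0, 0, 1, 0; 0, 0, 0, -1],
      !![1, 0, 0, 0; 0, 1, 0, 0; 0, 0, -1, 0; 0, 0, 0, -1]],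
    ![!![0, 0, 1, 0; 0, 0, 0, -1; 1, 0, 0, 0; 0, -1, 0, 0],
      !![0, 1, 0, 0; 1, 0, 0, 0; 0, 0, 0, -1; 0, 0, -1, 0]]]

/-- Integer matrices as elements of the C⋆-algebra of complex matrices. -/
noncomputable def intMatrixHom : Matrix (Fin 4) (Fin 4) ℤ →+*
    CStarMatrix (ULift.{w} (Fin 4)) (ULift.{w} (Fin 4)) ℂ :=
  (CStarMatrix.ofMatrixRingEquiv (n := ULift.{w} (Fin 4)) (A := ℂ)).toRingHom.comp
    ((Matrix.reindexRingEquiv ℂ (Equiv.ulift.{w}.symm : Fin 4 ≃ ULift.{w} (Fin 4))).toRingHom.comp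
      (Int.castRingHom ℂ).mapMatrix)

theorem intMatrixHom_apply (M : Matrix (Fin 4) (Fin 4) ℤ) (i j : ULift.{w} (Fin 4)) :
    intMatrixHom.{w} M i j = (M i.down j.down : ℂ) :=
  rfl

theorem isPauliGrid_intMatrixHom : IsPauliGrid (fun r p => intMatrixHom.{w} (pauliInt r p)) where
  isSelfAdjoint r p := by
    have h : ∀ r p, (pauliInt r p).transpose = pauliInt r p := by decide
    ext i j
    rw [CStarMatrix.star_apply, intMatrixHom_apply, intMatrixHom_apply,
      ← congrFun (congrFun (h r p) i.down) j.down, Matrix.transpose_apply]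
    simp
  mul_self r p := by
    have h : ∀ r p, pauliInt r p * pauliInt r p = 1 := by decide
    rw [← map_mul, h, map_one]
  commute_row r := by
    have h : ∀ r, pauliInt r 0 * pauliInt r 1 = pauliInt r 1 * pauliInt r 0 := by decide
    rw [commute_iff_eq, ← map_mul, ← map_mul, h]
  commute_col p := by
    have h : ∀ p, pauliInt 0 p * pauliInt 1 p = pauliInt 1 p * pauliInt 0 p := by decide
    rw [commute_iff_eq, ← map_mul, ← map_mul, h]
  mul_col p := by
    have h : ∀ p, pauliInt 2 p = pauliInt 0 p * pauliInt 1 p := by decide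
    rw [← map_mul, h]

theorem not_commute_intMatrixHom :
    ¬ Commute (intMatrixHom.{w} (pauliInt 0 0)) (intMatrixHom.{w} (pauliInt 1 1)) := by
  intro h
  have h1 := h.eq
  rw [← map_mul, ← map_mul] at h1
  have h2 := congrFun (congrFun h1 ⟨0⟩) ⟨2⟩
  rw [intMatrixHom_apply, intMatrixHom_apply] at h2
  have h3 := Int.cast_injective h2
  revert h3
  decide

end Pauli

/-! ### Changing signs in the graph of `K_{3,4}` -/

section SignChanges

theorem bijective_edgeK34 : Function.Bijective (fun p : Fin 3 × Fin 4 => edgeK34 p.1 p.2) :=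
  ⟨fun _ _ h => Prod.ext (edgeK34_injective h).1 (edgeK34_injective h).2,
    fun e => (exists_edgeK34 e).elim fun r ⟨j, h⟩ => ⟨(r, j), h.symm⟩⟩

/-- The edges of `K_{3,4}` as positions in a grid. -/
noncomputable def edgeEquivK34 : Fin 3 × Fin 4 ≃ K34.edgeSet :=
  Equiv.ofBijective _ bijective_edgeK34

@[simp] theorem edgeEquivK34_symm_apply (r : Fin 3) (j : Fin 4) :
    edgeEquivK34.symm (edgeK34 r j) = (r, j) :=
  edgeEquivK34.symm_apply_apply (r, j)

/-- The sign at the position `(r, j)` of the change of signs of the vertices of color `k` that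
belongs to `c`. It has product `1` over the edges at `k`. -/
def signChange (c : ℤˣ × ℤˣ) (r : Fin 3) (j : Fin 4) : Fin 3 ⊕ Fin 4 → ℤˣ
  | .inl _ => ![c.1, c.2, c.1, c.2] j
  | .inr _ => ![c.1, c.2, c.1 * c.2] r

theorem prod_signChange (c : ℤˣ × ℤˣ) (k : Fin 3 ⊕ Fin 4) :
    ∏ i : {i // incidenceMatrix K34 k i = 1},
      signChange c (edgeEquivK34.symm i.1).1 (edgeEquivK34.symm i.1).2 k = 1 := by
  rcases k with r | j
  · rw [prod_incidence_inl r (fun i => signChange c (edgeEquivK34.symm i).1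
      (edgeEquivK34.symm i).2 (.inl r))]
    simp only [edgeEquivK34_symm_apply]
    revert c r
    decide
  · rw [prod_incidence_inr j (fun i => signChange c (edgeEquivK34.symm i).1
      (edgeEquivK34.symm i).2 (.inr j))]
    simp only [edgeEquivK34_symm_apply]
    revert c j
    decide

/-- The change of signs on the vertices of the colored graph. -/
noncomputable def signAct (c : ℤˣ × ℤˣ) (v : SignVertexK34) : SignVertexK34 :=
  v.twist (fun i => signChange c (edgeEquivK34.symm i).1 (edgeEquivK34.symm i).2 v.1)
    (prod_signChange c v.1)

@[simp] theorem signAct_fst (c : ℤˣ × ℤˣ) (v : SignVertexK34) : (signAct c v).1 = v.1 :=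
  rfl

theorem sign_signAct (c : ℤˣ × ℤˣ) (v : SignVertexK34) (r : Fin 3) (j : Fin 4) :
    (signAct c v).sign (edgeK34 r j) = v.sign (edgeK34 r j) * (signChange c r j v.1 : ℤ) := by
  rw [signAct, SolutionVertex.sign_twist, edgeEquivK34_symm_apply]

@[simp] theorem signAct_signAct (c : ℤˣ × ℤˣ) (v : SignVertexK34) :
    signAct c (signAct c v) = v := by
  refine SolutionVertex.ext_sign rfl fun i _ => ?_
  obtain ⟨r, j, rfl⟩ := exists_edgeK34 i
  rw [sign_signAct, sign_signAct, signAct_fst, mul_assoc, ← Units.val_mul, Int.units_mul_self,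
    Units.val_one, mul_one]

theorem signAct_injective (c : ℤˣ × ℤˣ) : Function.Injective (signAct c) :=
  Function.LeftInverse.injective (signAct_signAct c)

theorem edgeColor_map_signAct (c : ℤˣ × ℤˣ) (e : SameEdgeK34) :
    starGraphK34.edgeColor (e.1.map (signAct c)) = starGraphK34.edgeColor e.1 := by
  obtain ⟨v, w, -, hvw, he⟩ := starGraphK34_exists_ends e
  rw [he, Sym2.map_mk, starGraphK34_edgeColor_of_eq hvw,
    starGraphK34_edgeColor_of_eq (v := signAct c v) (w := signAct c w) hvw]
  congr 1
  funext i
  obtain ⟨r, j, rfl⟩ := exists_edgeK34 i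
  rw [sign_signAct, sign_signAct, hvw, mul_mul_mul_comm, ← Units.val_mul, Int.units_mul_self,
    Units.val_one, mul_one]

/-- The change of signs on the subdivided edges. -/
noncomputable def edgeAct (c : ℤˣ × ℤˣ) (e : SameEdgeK34) : SameEdgeK34 :=
  ⟨e.1.map (signAct c), by
    obtain ⟨v, w, hne, hvw, he⟩ := starGraphK34_exists_ends e
    rw [he]
    exact ⟨(signAct_injective c).ne hne, Or.inl hvw⟩, by
    rw [edgeColor_map_signAct]
    exact e.2.2⟩

theorem edgeAct_edgeAct (c : ℤˣ × ℤˣ) (e : SameEdgeK34) : edgeAct c (edgeAct c e) = e := by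
  refine Subtype.ext ?_
  change (e.1.map (signAct c)).map (signAct c) = e.1
  rw [Sym2.map_map]
  have : signAct c ∘ signAct c = id := funext (signAct_signAct c)
  rw [this, Sym2.map_id, id]

theorem signAct_mem_edgeAct_iff (c : ℤˣ × ℤˣ) (v : SignVertexK34) (e : SameEdgeK34) :
    signAct c v ∈ (edgeAct c e).1 ↔ v ∈ e.1 := by
  change signAct c v ∈ e.1.map (signAct c) ↔ _
  rw [Sym2.mem_map]
  constructor
  · rintro ⟨w, hw, h⟩
    rwa [← signAct_injective c h]
  · exact fun h => ⟨v, h, rfl⟩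

/-- The change of signs on the base graph. -/
noncomputable def baseAct (c : ℤˣ × ℤˣ) :
    SignVertexK34 ⊕ SameEdgeK34 → SignVertexK34 ⊕ SameEdgeK34 :=
  Sum.map (signAct c) (edgeAct c)

theorem baseAct_baseAct (c : ℤˣ × ℤˣ) (b : SignVertexK34 ⊕ SameEdgeK34) :
    baseAct c (baseAct c b) = b := by
  rcases b with v | e
  · exact congrArg Sum.inl (signAct_signAct c v)
  · exact congrArg Sum.inr (edgeAct_edgeAct c e)

/-- The equation to which a vertex of the base graph belongs. -/
noncomputable def baseColor : SignVertexK34 ⊕ SameEdgeK34 → Fin 3 ⊕ Fin 4 :=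
  Sum.elim Sigma.fst (fun e => e.1.out.1.1)

theorem baseColor_inr {v : SignVertexK34} {e : SameEdgeK34} (h : v ∈ e.1) :
    baseColor (.inr e) = v.1 := by
  have h1 : e.1.out.1 ∈ e.1 := Sym2.out_fst_mem e.1
  change e.1.out.1.1 = v.1
  obtain ⟨a, b, -, hab, he⟩ := starGraphK34_exists_ends e
  generalize e.1.out.1 = x at h1 ⊢
  rw [he, Sym2.mem_iff] at h1 h
  rcases h1 with rfl | rfl <;> rcases h with rfl | rfl
  · rfl
  · exact hab
  · exact hab.symm
  · rfl

theorem baseColor_baseAct (c : ℤˣ × ℤˣ) (b : SignVertexK34 ⊕ SameEdgeK34) :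
    baseColor (baseAct c b) = baseColor b := by
  rcases b with v | e
  · rfl
  · have h : e.1.out.1 ∈ e.1 := Sym2.out_fst_mem e.1
    exact (baseColor_inr ((signAct_mem_edgeAct_iff c _ e).2 h)).trans (baseColor_inr h).symm

theorem pathLength_baseAct (n : Fin 3 ⊕ Fin 4 → ℕ) (m : Option (K34.edgeSet → ℤ) → ℕ)
    (c : ℤˣ × ℤˣ) (b : SignVertexK34 ⊕ SameEdgeK34) :
    starGraphK34.pathLength none n m (baseAct c b) = starGraphK34.pathLength none n m b := by
  rcases b with v | e
  · rfl
  · exact congrArg m (edgeColor_map_signAct c e)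

/-- Changes of signs preserve adjacency within the part of one equation. -/
theorem adj_baseAct_iff (c : ℤˣ × ℤˣ) {b b' : SignVertexK34 ⊕ SameEdgeK34}
    (h : baseColor b = baseColor b') :
    subdividedK34.Adj (baseAct c b) (baseAct c b') ↔ subdividedK34.Adj b b' := by
  rcases b with v | e <;> rcases b' with v' | e'
  · have key : ∀ w w' : SignVertexK34, w.1 = w'.1 →
        ¬ subdividedK34.Adj (Sum.inl w) (Sum.inl w') := by
      intro w w' hw hadj
      have := hadj.2
      rw [starGraphK34_edgeColor_of_eq hw] at this
      simp at this
    exact iff_of_false (key _ _ h) (key _ _ h)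
  · exact signAct_mem_edgeAct_iff c v e'
  · exact signAct_mem_edgeAct_iff c v' e
  · exact Iff.rfl

/-- Only original vertices are adjacent to vertices of the part of another equation. -/
theorem exists_of_adj_of_ne {b b' : SignVertexK34 ⊕ SameEdgeK34} (h : baseColor b ≠ baseColor b')
    (hadj : subdividedK34.Adj b b') : ∃ v v' r j, b = .inl v ∧ b' = .inl v' ∧
      incidenceMatrix K34 v.1 (edgeK34 r j) = 1 ∧ incidenceMatrix K34 v'.1 (edgeK34 r j) = 1 := by
  rcases b with v | e <;> rcases b' with v' | e'
  · rcases hadj.1.2 with h1 | ⟨i, hi⟩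
    · exact (h h1).elim
    · obtain ⟨r, j, rfl⟩ := exists_edgeK34 i
      exact ⟨v, v', r, j, rfl, rfl, incidence_of_sign_mul_sign hi⟩
  · exact (h (baseColor_inr hadj).symm).elim
  · exact (h (baseColor_inr hadj)).elim
  · exact hadj.elim

end SignChanges

/-! ### Quantum symmetry -/

section QuantumSymmetry

variable {A : Type*} [CStarAlgebra A] {y : Fin 3 → Fin 2 → A}

/-- The pair of commuting self-adjoint unitaries that generates the solution of the equation `k`. -/
def gridPair (y : Fin 3 → Fin 2 → A) : Fin 3 ⊕ Fin 4 → A × A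
  | .inl r => (y r 0, y r 1)
  | .inr j => (y 0 (![0, 1, 0, 1] j), y 1 (![0, 1, 0, 1] j))

/-- The projection-valued measures on the changes of signs given by a solution of the linear
system. -/
noncomputable def gridMeasure (y : Fin 3 → Fin 2 → A) (k : Fin 3 ⊕ Fin 4) (c : ℤˣ × ℤˣ) : A :=
  jointProjection (gridPair y k).1 (gridPair y k).2 c

theorem isStarProjection_gridMeasure (hy : IsPauliGrid y) (k : Fin 3 ⊕ Fin 4) (c : ℤˣ × ℤˣ) :
    IsStarProjection (gridMeasure y k c) := by
  rcases k with r | j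
  · exact isStarProjection_jointProjection (hy.isSelfAdjoint _ _) (hy.isSelfAdjoint _ _)
      (hy.mul_self _ _) (hy.mul_self _ _) (hy.commute_row r) c
  · exact isStarProjection_jointProjection (hy.isSelfAdjoint _ _) (hy.isSelfAdjoint _ _)
      (hy.mul_self _ _) (hy.mul_self _ _) (hy.commute_col _) c

theorem sum_gridMeasure_inl (y : Fin 3 → Fin 2 → A) (r : Fin 3) (j : Fin 4) (t : ℤˣ) :
    ∑ c, (if signChange c r j (.inl r) = t then gridMeasure y (.inl r) c else 0) =
      (1 / 2 : ℂ) • (1 + (t : ℤ) • y r (![0, 1, 0, 1] j)) := by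
  fin_cases j
  · exact sum_jointProjection_fst (y r 0) (y r 1) t
  · exact sum_jointProjection_snd (y r 0) (y r 1) t
  · exact sum_jointProjection_fst (y r 0) (y r 1) t
  · exact sum_jointProjection_snd (y r 0) (y r 1) t

theorem sum_gridMeasure_inr (hy : IsPauliGrid y) (r : Fin 3) (j : Fin 4) (t : ℤˣ) :
    ∑ c, (if signChange c r j (.inr j) = t then gridMeasure y (.inr j) c else 0) =
      (1 / 2 : ℂ) • (1 + (t : ℤ) • y r (![0, 1, 0, 1] j)) := by
  fin_cases r
  · exact sum_jointProjection_fst _ _ t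
  · exact sum_jointProjection_snd _ _ t
  · exact (sum_jointProjection_mul _ _ t).trans
      (congrArg (fun a => (1 / 2 : ℂ) • (1 + (t : ℤ) • a)) (hy.mul_col _).symm)

/-- The measures of the two equations with the variable `(r, j)` give the same distribution of the
sign at `(r, j)`. -/
theorem sum_gridMeasure_eq (hy : IsPauliGrid y) {k l : Fin 3 ⊕ Fin 4} (hkl : k ≠ l) {r : Fin 3}
    {j : Fin 4} (hk : incidenceMatrix K34 k (edgeK34 r j) = 1)
    (hl : incidenceMatrix K34 l (edgeK34 r j) = 1) (t : ℤˣ) :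
    ∑ c, (if signChange c r j k = t then gridMeasure y k c else 0) =
      ∑ c, (if signChange c r j l = t then gridMeasure y l c else 0) := by
  rw [incidenceMatrix_eq_one_iff] at hk hl
  rcases k with r' | j' <;> rcases l with r'' | j''
  · rw [inl_mem_edgeK34_iff] at hk hl
    exact (hkl (by rw [hk, hl])).elim
  · obtain rfl := inl_mem_edgeK34_iff.1 hk
    obtain rfl := inr_mem_edgeK34_iff.1 hl
    rw [sum_gridMeasure_inl, sum_gridMeasure_inr hy]
  · obtain rfl := inl_mem_edgeK34_iff.1 hl
    obtain rfl := inr_mem_edgeK34_iff.1 hk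
    rw [sum_gridMeasure_inl, sum_gridMeasure_inr hy]
  · rw [inr_mem_edgeK34_iff] at hk hl
    exact (hkl (by rw [hk, hl])).elim

open Classical in
theorem sum_adj_baseAct (hy : IsPauliGrid y) {b b' : SignVertexK34 ⊕ SameEdgeK34}
    (h : baseColor b ≠ baseColor b') :
    ∑ c, (if subdividedK34.Adj (baseAct c b) b' then gridMeasure y (baseColor b) c else 0) =
      ∑ c, (if subdividedK34.Adj b (baseAct c b') then gridMeasure y (baseColor b') c else 0) := by
  by_cases hex : ∃ v v' r j, b = .inl v ∧ b' = .inl v' ∧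
      incidenceMatrix K34 v.1 (edgeK34 r j) = 1 ∧ incidenceMatrix K34 v'.1 (edgeK34 r j) = 1
  · obtain ⟨v, v', r, j, rfl, rfl, hv, hv'⟩ := hex
    have hne : v.1 ≠ v'.1 := h
    have hu : ∀ α β γ : ℤˣ, (α : ℤ) * γ * β = -1 ↔ γ = -(α * β) := by decide
    have hu' : ∀ α β γ : ℤˣ, (α : ℤ) * (β * γ) = -1 ↔ γ = -(α * β) := by decide
    have e1 : ∀ c, subdividedK34.Adj (baseAct c (.inl v)) (.inl v') ↔
        signChange c r j v.1 = -(v.2.1 ⟨_, hv⟩ * v'.2.1 ⟨_, hv'⟩) := by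
      intro c
      refine (subdivided_adj_inl_iff (v := signAct c v) hne hv hv').trans ?_
      rw [sign_signAct, v.sign_of_eq hv, v'.sign_of_eq hv', hu]
    have e2 : ∀ c, subdividedK34.Adj (.inl v) (baseAct c (.inl v')) ↔
        signChange c r j v'.1 = -(v.2.1 ⟨_, hv⟩ * v'.2.1 ⟨_, hv'⟩) := by
      intro c
      refine (subdivided_adj_inl_iff (w := signAct c v') hne hv hv').trans ?_
      rw [sign_signAct, v.sign_of_eq hv, v'.sign_of_eq hv', hu']
    simp only [e1, e2]
    exact sum_gridMeasure_eq hy hne hv hv' _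
  · have e1 : ∀ c, ¬ subdividedK34.Adj (baseAct c b) b' := by
      intro c hadj
      obtain ⟨v, v', r, j, h1, h2, h3, h4⟩ :=
        exists_of_adj_of_ne (by rwa [baseColor_baseAct]) hadj
      exact hex ⟨signAct c v, v', r, j, by rw [← baseAct_baseAct c b, h1]; rfl, h2, h3, h4⟩
    have e2 : ∀ c, ¬ subdividedK34.Adj b (baseAct c b') := by
      intro c hadj
      obtain ⟨v, v', r, j, h1, h2, h3, h4⟩ :=
        exists_of_adj_of_ne (by rwa [baseColor_baseAct]) hadj
      exact hex ⟨v, signAct c v', r, j, h1, by rw [← baseAct_baseAct c b', h2]; rfl, h3, h4⟩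
    simp [e1, e2]

section Lift

variable {W : Type} {G : SimpleGraph W} {len : SignVertexK34 ⊕ SameEdgeK34 → ℕ}
  (P : PathAttachment G subdividedK34 len) (hlen : ∀ c b, len (baseAct c b) = len b)

/-- The change of signs on the graph with attached paths. -/
noncomputable def PathAttachment.act (c : ℤˣ × ℤˣ) (x : W) : W :=
  (P.exists_eq (baseAct c (P.base x)) (P.level x) (by rw [hlen]; exact P.level_le x)).choose

@[simp] theorem PathAttachment.base_act (c : ℤˣ × ℤˣ) (x : W) :
    P.base (P.act hlen c x) = baseAct c (P.base x) :=
  (P.exists_eq (baseAct c (P.base x)) (P.level x)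
    (by rw [hlen]; exact P.level_le x)).choose_spec.1

@[simp] theorem PathAttachment.level_act (c : ℤˣ × ℤˣ) (x : W) :
    P.level (P.act hlen c x) = P.level x :=
  (P.exists_eq (baseAct c (P.base x)) (P.level x)
    (by rw [hlen]; exact P.level_le x)).choose_spec.2

theorem PathAttachment.act_act (c : ℤˣ × ℤˣ) (x : W) : P.act hlen c (P.act hlen c x) = x :=
  P.ext (by simp [baseAct_baseAct]) (by simp)

theorem PathAttachment.adj_act_iff (c : ℤˣ × ℤˣ) {x z : W}
    (h : baseColor (P.base x) = baseColor (P.base z)) :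
    G.Adj (P.act hlen c x) (P.act hlen c z) ↔ G.Adj x z := by
  have hinj : baseAct c (P.base x) = baseAct c (P.base z) ↔ P.base x = P.base z :=
    (Function.LeftInverse.injective (baseAct_baseAct c)).eq_iff
  simp only [P.adj_iff, P.base_act, P.level_act, adj_baseAct_iff c h, hinj]

open Classical in
theorem PathAttachment.sum_adj_act [Fintype W] (hy : IsPauliGrid y) (x z : W) :
    ∑ c, (if G.Adj (P.act hlen c x) z then gridMeasure y (baseColor (P.base x)) c else 0) =
      ∑ c, (if G.Adj x (P.act hlen c z) then gridMeasure y (baseColor (P.base z)) c else 0) := by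
  by_cases h : baseColor (P.base x) = baseColor (P.base z)
  · refine Finset.sum_congr rfl fun c _ => ?_
    have : G.Adj (P.act hlen c x) z ↔ G.Adj x (P.act hlen c z) := by
      conv_lhs => rw [← P.act_act hlen c z]
      exact P.adj_act_iff hlen c (by rw [P.base_act, baseColor_baseAct, h])
    simp only [this, h]
  · have e1 : ∀ c, G.Adj (P.act hlen c x) z ↔ (P.level x = 0 ∧ P.level z = 0) ∧
        subdividedK34.Adj (baseAct c (P.base x)) (P.base z) := by
      intro c
      have hne : baseAct c (P.base x) ≠ P.base z := fun hc =>
        h (by rw [← hc, baseColor_baseAct])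
      simp [P.adj_iff, hne, and_assoc]
    have e2 : ∀ c, G.Adj x (P.act hlen c z) ↔ (P.level x = 0 ∧ P.level z = 0) ∧
        subdividedK34.Adj (P.base x) (baseAct c (P.base z)) := by
      intro c
      have hne : P.base x ≠ baseAct c (P.base z) := fun hc =>
        h (by rw [hc, baseColor_baseAct])
      simp [P.adj_iff, hne, and_assoc]
    simp only [e1, e2]
    by_cases hl : P.level x = 0 ∧ P.level z = 0
    · simp only [hl, true_and]
      exact sum_adj_baseAct hy h
    · simp [hl]

/-- The quantum automorphism given by a solution of the linear system. -/
noncomputable def PathAttachment.gridUnitary (y : Fin 3 → Fin 2 → A) [Fintype W] :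
    Matrix W W A :=
  blockUnitary (fun x => baseColor (P.base x)) (P.act hlen) (gridMeasure y)

theorem PathAttachment.isQuantumAutomorphism_gridUnitary [Fintype W] (hy : IsPauliGrid y) :
    IsQuantumAutomorphism G (P.gridUnitary hlen y) :=
  isQuantumAutomorphism_blockUnitary (P.act_act hlen)
    (fun c x => by rw [P.base_act, baseColor_baseAct])
    (isStarProjection_gridMeasure hy) (fun _ => sum_jointProjection _ _)
    (P.sum_adj_act hlen hy)

open Classical in
/-- The solution is recovered from the row of the vertex `(r, 1)`, by summing over the vertices with
sign `1` at `(r, j)`. -/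
theorem PathAttachment.sum_gridUnitary [Fintype W] (y : Fin 3 → Fin 2 → A) (r : Fin 3)
    (j : Fin 4) :
    ∑ z, (if ∃ v : SignVertexK34, P.base z = .inl v ∧ v.sign (edgeK34 r j) = 1 then
      P.gridUnitary hlen y (P.root (.inl (.one _ (.inl r)))) z else 0) =
      (1 / 2 : ℂ) • (1 + y r (![0, 1, 0, 1] j)) := by
  have h1 := sum_gridMeasure_inl y r j 1
  rw [Units.val_one, one_smul] at h1
  rw [← h1]
  simp only [gridUnitary, blockUnitary, P.base_root]
  have h2 : ∀ z, (if ∃ v : SignVertexK34, P.base z = .inl v ∧ v.sign (edgeK34 r j) = 1 then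
      ∑ c, (if P.act hlen c (P.root (.inl (.one _ (.inl r)))) = z then
        gridMeasure y (baseColor (.inl (.one _ (.inl r)))) c else 0) else 0) =
      ∑ c, (if P.act hlen c (P.root (.inl (.one _ (.inl r)))) = z then
        (if ∃ v : SignVertexK34, P.base z = .inl v ∧ v.sign (edgeK34 r j) = 1 then
          gridMeasure y (.inl r) c else 0) else 0) := by
    intro z
    by_cases hz : ∃ v : SignVertexK34, P.base z = .inl v ∧ v.sign (edgeK34 r j) = 1
    · simp only [hz, if_true]
      rfl
    · simp [hz]
  simp only [h2]
  rw [Finset.sum_comm]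
  refine Finset.sum_congr rfl fun c _ => ?_
  rw [Finset.sum_ite_eq, if_pos (Finset.mem_univ _), P.base_act, P.base_root]
  have h3 : (∃ v : SignVertexK34, baseAct c (.inl (.one _ (.inl r))) = .inl v ∧
      v.sign (edgeK34 r j) = 1) ↔ signChange c r j (.inl r) = 1 := by
    have h4 : (signAct c (.one _ (.inl r))).sign (edgeK34 r j) =
        (signChange c r j (.inl r) : ℤ) := by
      rw [sign_signAct, SolutionVertex.sign_one (incidenceMatrix_inl r j), one_mul]
      rfl
    constructor
    · rintro ⟨v, hv, hs⟩
      obtain rfl : signAct c (.one _ (.inl r)) = v := Sum.inl_injective hv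
      exact Units.ext (h4.symm.trans hs)
    · intro hs
      exact ⟨_, rfl, h4.trans (by rw [hs]; rfl)⟩
  simp only [h3]

/-- The entries do not commute if the solution does not. -/
theorem PathAttachment.exists_not_commute_gridUnitary [Fintype W] (y : Fin 3 → Fin 2 → A)
    (h : ¬ Commute (y 0 0) (y 1 1)) : ∃ a b a' b', ¬ Commute (P.gridUnitary hlen y a b)
      (P.gridUnitary hlen y a' b') := by
  classical
  by_contra! hc
  have h1 : Commute ((1 / 2 : ℂ) • (1 + y 0 0)) ((1 / 2 : ℂ) • (1 + y 1 1)) := by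
    have e0 := P.sum_gridUnitary hlen y 0 0
    have e1 := P.sum_gridUnitary hlen y 1 1
    simp only [Matrix.cons_val_zero, Matrix.cons_val_one] at e0 e1
    rw [← e0, ← e1]
    refine Commute.sum_left _ _ _ fun z _ => Commute.sum_right _ _ _ fun z' _ => ?_
    split_ifs
    · exact hc _ _ _ _
    · exact Commute.zero_right _
    · exact Commute.zero_left _
    · exact Commute.zero_left _
  have h2 : ∀ s : A, s = (2 : ℂ) • ((1 / 2 : ℂ) • (1 + s)) - 1 := fun s => by
    rw [smul_smul]
    norm_num
  refine h ?_
  rw [h2 (y 0 0), h2 (y 1 1)]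
  exact ((h1.smul_left _).smul_right _ |>.sub_left (Commute.one_left _)).sub_right
    (Commute.one_right _)

end Lift

/-- A quantum automorphism with noncommuting entries shows quantum symmetry. -/
theorem hasQuantumSymmetry_of_not_commute {V : Type} [Fintype V] {G : SimpleGraph V} {B : Type w}
    [CStarAlgebra B] [Nontrivial B] {u : Matrix V V B} (hu : IsQuantumAutomorphism G u)
    {a b a' b' : V} (h : ¬ Commute (u a b) (u a' b')) : HasQuantumSymmetry.{w} G := by
  obtain ⟨φ, hφ, -⟩ := qutAlgebra_universal.{w} G B u hu
  refine ⟨qutMatrix G a b, qutMatrix G a' b', fun hc => h ?_⟩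
  have := congrArg φ hc
  rwa [map_mul, map_mul, hφ, hφ] at this

open scoped ComplexOrder in
theorem hasQuantumSymmetry_starGraphK34 (n : Fin 3 ⊕ Fin 4 → ℕ)
    (m : Option (K34.edgeSet → ℤ) → ℕ) : HasQuantumSymmetry.{w} (starGraphK34'' n m) := by
  let P := starGraphK34.pathAttachment none n m
  obtain ⟨a, b, a', b', h⟩ := P.exists_not_commute_gridUnitary (pathLength_baseAct n m)
    (fun r p => intMatrixHom.{w} (pauliInt r p)) not_commute_intMatrixHom.{w}
  exact hasQuantumSymmetry_of_not_commute
    (P.isQuantumAutomorphism_gridUnitary (pathLength_baseAct n m) isPauliGrid_intMatrixHom.{w}) h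

end QuantumSymmetry

theorem corollary5p6
    (n : Fin 3 ⊕ Fin 4 → ℕ) (hn : Function.Injective n)
    (m : Option (K34.edgeSet → ℤ) → ℕ)
    (hm : Set.InjOn m {c | c ≠ none ∧ ∃ e ∈ starGraphK34.graph.edgeSet, starGraphK34.edgeColor e = c}) :
    HasQuantumSymmetry.{w} (starGraphK34'' n m) ∧ HasFiniteQut.{w} (starGraphK34'' n m) := by
  exact ⟨hasQuantumSymmetry_starGraphK34 n m, hasFiniteQut_starGraphK34 n m hn hm⟩
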